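/- **Theorem (perfect hydrodynamic cloaking and shielding for confocal ellipses).** Let $l>0$ and let $(\xi,\eta)$, $\xi\ge 0$, $0\le\eta<2\pi$, be the elliptic coordinates of the plane, $x_1=l\cosh\xi\cos\eta$, $x_2=l\sinh\xi\sin\eta$. Let $0<\xi_i<\xi_e$, and let $D=\{\xi<\xi_i\}$ and $\Omega=\{\xi<\xi_e\}$ be the confocal elliptic domains of elliptic radii $\xi_i$ and $\xi_e$. For $\zeta_0\in\mathbb R$ and harmonic $H,P:\mathbb R^2\to\mathbb R$ consider the system for $(\varphi,p)$ $$ \begin{cases} \Delta\varphi=0 & \text{in }\mathbb R^2\setminus\overline D,\\ \partial\varphi/\partial\nu=0 & \text{on }\partial D,\\ \varphi=H+O(|x|^{-1}) & \text{as }|x|\to\infty,\\ \Delta p=0 & \text{in }(\mathbb R^2\setminus\overline D)\setminus\partial\Omega,\\ \partial p/\partial\nu=0 & \text{on }\partial D,\\ p|_+=p|_- & \text{on }\partial\Omega,\\ \frac{\partial p}{\partial\nu}\big|_+-\frac{\partial p}{\partial\nu}\big|_-=12\,\zeta_0\,\frac{\partial\varphi}{\partial\nu} & \text{on }\partial\Omega,\\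 p=P+O(|x|^{-1}) & \text{as }|x|\to\infty, \end{cases} $$ where $\nu$ is the outward unit normal of the respective ellipse, $\frac{\partial f}{\partial\nu}|_\pm(x)=\lim_{t\to0^+}\langle\nabla f(x\pm t\nu(x)),\nu(x)\rangle$, and the conditions on $\partial D$ are understood with the limit from outside. A classical solution is a pair $\varphi,p$ of functions continuous on $\mathbb R^2\setminus D$, with $\varphi$ of class $C^2$ in $\mathbb R^2\setminus\overline D$ and $p$ of class $C^2$ in $(\mathbb R^2\setminus\overline D)\setminus\partial\Omega$, that satisfies the system. Let $\zeta_{mean}=\zeta_0$ in $\Omega\setminus\overline D$ and $\zeta_{mean}=0$ in $\mathbb R^2\setminus\overline\Omega$, let $u=-\frac1{12}\nabla p-\zeta_{mean}\nabla\varphi$ be the averaged velocity, and let $F=\int_{\partial D}(-p)\,\nu\,ds$ be the force on the object. *Perfect cloaking* means that the system has a classical solution and that every classical solution satisfies $u=-\nabla P/12$ in $\mathbb R^2\setminus\overline\Omega$; *perfect shielding* means that the system has a classical solution and that every classical solution satisfies $F=0$. Let $n\ge1$ be an integer. 1. Let $H=\cosh(n\xi)\cos(n\eta)$ and $P=12\cosh(n\xi)\cos(n\eta)$.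 Perfect cloaking holds for $$\zeta_0=\frac{\sinh(n\xi_i)}{\big(\sinh(n\xi_e)-e^{n(\xi_i-\xi_e)}\sinh(n\xi_i)\big)\cosh(n(\xi_e-\xi_i))},$$ and perfect shielding holds for $$\zeta_0=\frac{e^{n\xi_e}}{\sinh(n\xi_e)-e^{n(\xi_i-\xi_e)}\sinh(n\xi_i)}.$$ 2. Let $H=\sinh(n\xi)\sin(n\eta)$ and $P=12\sinh(n\xi)\sin(n\eta)$. Perfect cloaking holds for $$\zeta_0=\frac{\cosh(n\xi_i)}{\big(\cosh(n\xi_e)-e^{n(\xi_i-\xi_e)}\cosh(n\xi_i)\big)\cosh(n(\xi_e-\xi_i))},$$ and perfect shielding holds for $$\zeta_0=\frac{e^{n\xi_e}}{\cosh(n\xi_e)-e^{n(\xi_i-\xi_e)}\cosh(n\xi_i)}.$$ 3. The two shielding values in 1 and 2 coincide. -/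

import Mathlib

open Filter Topology MeasureTheory Asymptotics
open scoped Gradient

noncomputable section

namespace ElectroOsmosis

/-- The Euclidean plane `ℝ²`. -/
abbrev Plane : Type := EuclideanSpace ℝ (Fin 2)

/-! ### Outward normals and one-sided normal derivatives -/

/-- `ν` is the outward unit normal at the boundary point `x` of a set `U` with `C¹` boundary near
`x`: locally `U = {ρ < 0}` for a `C¹` function `ρ` with `ρ x = 0`, and `∇ρ(x)` is a positive
multiple of the unit vector `ν`. -/
def IsOutwardUnitNormal (U : Set Plane) (x ν : Plane) : Prop :=
  ‖ν‖ = 1 ∧ ∃ ρ : Plane → ℝ, ContDiffAt ℝ 1 ρ x ∧ ρ x = 0 ∧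
    (∃ c : ℝ, 0 < c ∧ ∇ ρ x = c • ν) ∧ ∀ᶠ y in 𝓝 x, (y ∈ U ↔ ρ y < 0)

open Classical in
/-- The outward unit normal field of `U` (with the value `0` where there is no normal). -/
def outwardNormal (U : Set Plane) (x : Plane) : Plane :=
  if h : ∃ ν, IsOutwardUnitNormal U x ν then h.choose else 0

/-- `∂f/∂ν|₊ (x) = a`, the limit of `⟨∇f(x + tν), ν⟩` as `t → 0⁺`. -/
def HasOuterNormalDeriv (U : Set Plane) (f : Plane → ℝ) (x : Plane) (a : ℝ) : Prop :=
  Tendsto (fun t : ℝ => inner ℝ (∇ f (x + t • outwardNormal U x)) (outwardNormal U x))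
    (𝓝[>] 0) (𝓝 a)

/-- `∂f/∂ν|₋ (x) = a`, the limit of `⟨∇f(x - tν), ν⟩` as `t → 0⁺`. -/
def HasInnerNormalDeriv (U : Set Plane) (f : Plane → ℝ) (x : Plane) (a : ℝ) : Prop :=
  Tendsto (fun t : ℝ => inner ℝ (∇ f (x - t • outwardNormal U x)) (outwardNormal U x))
    (𝓝[>] 0) (𝓝 a)

/-! ### The electro-osmotic system -/

/-- The zeta potential: `ζ₀` in the control region `Ω ∖ closure D`, and `0` elsewhere. -/
def zetaMean (D Ω : Set Plane) (ζ₀ : ℝ) : Plane → ℝ :=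
  (Ω \ closure D).indicator fun _ => ζ₀

/-- `(φ, p)` is a classical solution of the electro-osmotic system for the object `D`, the outer
domain `Ω`, the zeta potential `ζ₀` and the background fields `H`, `P`. The functions are total;
their values in `D` play no role. -/
structure IsSolution (D Ω : Set Plane) (ζ₀ : ℝ) (H P φ p : Plane → ℝ) : Prop where
  /-- `φ` is continuous up to the boundary of the object. -/
  phi_cont : ContinuousOn φ Dᶜ
  /-- `φ` is `C²` with `Δφ = 0` outside the closure of the object. -/
  phi_harmonic : InnerProductSpace.HarmonicOnNhd φ (closure D)ᶜ
  /-- `∂φ/∂ν = 0` on `∂D`. -/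
  phi_neumann : ∀ x ∈ frontier D, HasOuterNormalDeriv D φ x 0
  /-- `φ = H + O(|x|⁻¹)` at infinity. -/
  phi_infty : (fun x => φ x - H x) =O[Bornology.cobounded Plane] fun x => ‖x‖⁻¹
  /-- `p` is continuous up to the boundary of the object; in particular `p|₊ = p|₋` on `∂Ω`. -/
  p_cont : ContinuousOn p Dᶜ
  /-- `p` is `C²` with `Δp = 0` outside the closure of the object, on both sides of `∂Ω`. -/
  p_harmonic : InnerProductSpace.HarmonicOnNhd p ((closure D)ᶜ \ frontier Ω)
  /-- `∂p/∂ν = 0` on `∂D`. -/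
  p_neumann : ∀ x ∈ frontier D, HasOuterNormalDeriv D p x 0
  /-- `∂p/∂ν|₊ - ∂p/∂ν|₋ = 12 ζ₀ ∂φ/∂ν` on `∂Ω`, both one-sided limits existing. -/
  p_jump : ∀ x ∈ frontier Ω, ∃ a b : ℝ, HasOuterNormalDeriv Ω p x a ∧
    HasInnerNormalDeriv Ω p x b ∧ a - b = 12 * ζ₀ * inner ℝ (∇ φ x) (outwardNormal Ω x)
  /-- `p = P + O(|x|⁻¹)` at infinity. -/
  p_infty : (fun x => p x - P x) =O[Bornology.cobounded Plane] fun x => ‖x‖⁻¹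

/-- The depth-averaged velocity `u = -∇p/12 - ζ ∇φ`. -/
def averVelocity (D Ω : Set Plane) (ζ₀ : ℝ) (φ p : Plane → ℝ) (x : Plane) : Plane :=
  -((1 / 12 : ℝ) • ∇ p x) - zetaMean D Ω ζ₀ x • ∇ φ x

/-- The force on the object, the integral of `σ ν` over `∂D` with respect to arc length, where
`σ = -p I`. -/
def force (D : Set Plane) (p : Plane → ℝ) : Plane :=
  ∫ x in frontier D, (-p x) • outwardNormal D x ∂(Measure.hausdorffMeasure 1)

/-- Perfect hydrodynamic cloaking: the system is solvable, and the velocity of its solution is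
`-∇P/12` outside the closure of `Ω`. -/
def IsPerfectCloaking (D Ω : Set Plane) (ζ₀ : ℝ) (H P : Plane → ℝ) : Prop :=
  (∃ φ p, IsSolution D Ω ζ₀ H P φ p) ∧
    ∀ φ p, IsSolution D Ω ζ₀ H P φ p →
      ∀ x ∈ (closure Ω)ᶜ, averVelocity D Ω ζ₀ φ p x = -((1 / 12 : ℝ) • ∇ P x)

/-- Perfect hydrodynamic shielding: the system is solvable, and the force that its solution exerts
on the object vanishes. -/
def IsPerfectShielding (D Ω : Set Plane) (ζ₀ : ℝ) (H P : Plane → ℝ) : Prop :=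
  (∃ φ p, IsSolution D Ω ζ₀ H P φ p) ∧
    ∀ φ p, IsSolution D Ω ζ₀ H P φ p → force D p = 0

/-! ### Elliptic coordinates -/

/-- The point with elliptic coordinates `(ξ, η)`, for the foci `(±l, 0)`. -/
def ellipticPoint (l ξ η : ℝ) : Plane :=
  !₂[l * Real.cosh ξ * Real.cos η, l * Real.sinh ξ * Real.sin η]

/-- The open domain bounded by the ellipse of elliptic radius `r` with foci `(±l, 0)`. -/
def ellipse (l r : ℝ) : Set Plane :=
  {x | ∃ ξ η : ℝ, 0 ≤ ξ ∧ ξ < r ∧ x = ellipticPoint l ξ η}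

theorem exists_ellipticCoords {l : ℝ} (hl : 0 < l) (x : Plane) :
    ∃ c : ℝ × ℝ, 0 ≤ c.1 ∧ 0 ≤ c.2 ∧ c.2 < 2 * Real.pi ∧ ellipticPoint l c.1 c.2 = x := by
  have key : ∃ ξ η : ℝ, 0 ≤ ξ ∧ ellipticPoint l ξ η = x := by
    obtain ⟨w, hw⟩ := Complex.cos_surjective (⟨x 0 / l, x 1 / l⟩ : ℂ)
    have h0 : Real.cos w.re * Real.cosh w.im = x 0 / l := by
      have := congrArg Complex.re hw
      rw [Complex.cos_eq] at this
      simpa [← Complex.ofReal_cos, ← Complex.ofReal_sin, ← Complex.ofReal_cosh,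
        ← Complex.ofReal_sinh] using this
    have h1 : -(Real.sin w.re * Real.sinh w.im) = x 1 / l := by
      have := congrArg Complex.im hw
      rw [Complex.cos_eq] at this
      simpa [← Complex.ofReal_cos, ← Complex.ofReal_sin, ← Complex.ofReal_cosh,
        ← Complex.ofReal_sinh] using this
    rw [eq_div_iff hl.ne'] at h0 h1
    rcases le_total 0 w.im with h | h
    · refine ⟨w.im, -w.re, h, ?_⟩
      ext i
      fin_cases i
      · simp only [ellipticPoint, Real.cos_neg]
        simpa [mul_comm, mul_assoc, mul_left_comm] using h0
      · simp only [ellipticPoint, Real.sin_neg]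
        simpa [mul_comm, mul_assoc, mul_left_comm] using h1
    · refine ⟨-w.im, w.re, neg_nonneg.2 h, ?_⟩
      ext i
      fin_cases i
      · simp only [ellipticPoint, Real.cosh_neg]
        simpa [mul_comm, mul_assoc, mul_left_comm] using h0
      · simp only [ellipticPoint, Real.sinh_neg]
        simpa [mul_comm, mul_assoc, mul_left_comm] using h1
  obtain ⟨ξ, η, hξ, hx⟩ := key
  refine ⟨(ξ, toIcoMod Real.two_pi_pos 0 η), hξ, ?_, ?_, ?_⟩
  · exact (toIcoMod_mem_Ico Real.two_pi_pos 0 η).1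
  · simpa using (toIcoMod_mem_Ico Real.two_pi_pos 0 η).2
  · rw [← hx]
    simp only [ellipticPoint, toIcoMod, zsmul_eq_mul, Real.cos_sub_int_mul_two_pi,
      Real.sin_sub_int_mul_two_pi]

open Classical in
/-- Elliptic coordinates `(ξ, η)` of a point, `ξ ≥ 0` and `0 ≤ η < 2π`. They are unique off the open
segment between the foci. -/
def ellipticCoords (l : ℝ) (x : Plane) : ℝ × ℝ :=
  Classical.epsilon fun c : ℝ × ℝ =>
    0 ≤ c.1 ∧ 0 ≤ c.2 ∧ c.2 < 2 * Real.pi ∧ ellipticPoint l c.1 c.2 = x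

theorem ellipticCoords_spec {l : ℝ} (hl : 0 < l) (x : Plane) :
    0 ≤ (ellipticCoords l x).1 ∧ 0 ≤ (ellipticCoords l x).2 ∧
      (ellipticCoords l x).2 < 2 * Real.pi ∧
      ellipticPoint l (ellipticCoords l x).1 (ellipticCoords l x).2 = x :=
  Classical.epsilon_spec (exists_ellipticCoords hl x)

/-- The background field `cosh(nξ) cos(nη)`. -/
def fieldCos (l : ℝ) (n : ℕ) (x : Plane) : ℝ :=
  Real.cosh (n * (ellipticCoords l x).1) * Real.cos (n * (ellipticCoords l x).2)

/-- The background field `sinh(nξ) sin(nη)`. -/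
def fieldSin (l : ℝ) (n : ℕ) (x : Plane) : ℝ :=
  Real.sinh (n * (ellipticCoords l x).1) * Real.sin (n * (ellipticCoords l x).2)

theorem cosh_nat_mul (n : ℕ) (ξ η : ℝ) :
    Complex.cosh (n * (ξ + η * Complex.I)) =
      ⟨Real.cosh (n * ξ) * Real.cos (n * η), Real.sinh (n * ξ) * Real.sin (n * η)⟩ := by
  have h : (n * (ξ + η * Complex.I) : ℂ) = ((n * ξ : ℝ) : ℂ) + ((n * η : ℝ) : ℂ) * Complex.I := by
    push_cast; ring
  rw [h]
  generalize (n * ξ : ℝ) = a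
  generalize (n * η : ℝ) = b
  rw [Complex.cosh_add, Complex.cosh_mul_I, Complex.sinh_mul_I, ← Complex.ofReal_cosh,
    ← Complex.ofReal_sinh, ← Complex.ofReal_cos, ← Complex.ofReal_sin]
  apply Complex.ext <;> simp [-Complex.ofReal_sinh, -Complex.ofReal_cosh,
    -Complex.ofReal_sin, -Complex.ofReal_cos]

/-- The fields do not depend on the choice of the elliptic coordinates of a point. -/
theorem field_ellipticPoint {l : ℝ} (hl : 0 < l) (n : ℕ) (ξ η : ℝ) :
    fieldCos l n (ellipticPoint l ξ η) = Real.cosh (n * ξ) * Real.cos (n * η) ∧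
      fieldSin l n (ellipticPoint l ξ η) = Real.sinh (n * ξ) * Real.sin (n * η) := by
  obtain ⟨-, -, -, h⟩ := ellipticCoords_spec hl (ellipticPoint l ξ η)
  set c := ellipticCoords l (ellipticPoint l ξ η) with hc
  have h0 := congrArg (fun y : Plane => y 0) h
  have h1 := congrArg (fun y : Plane => y 1) h
  simp only [ellipticPoint, PiLp.toLp_apply, Matrix.cons_val_zero, Matrix.cons_val_one,
    mul_assoc] at h0 h1
  have h0' := mul_left_cancel₀ hl.ne' h0
  have h1' := mul_left_cancel₀ hl.ne' h1
  have e : Complex.cosh (c.1 + c.2 * Complex.I) = Complex.cosh (ξ + η * Complex.I) := by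
    have a := cosh_nat_mul 1 c.1 c.2
    have b := cosh_nat_mul 1 ξ η
    simp only [Nat.cast_one, one_mul] at a b
    rw [a, b, h0', h1']
  have e' : Complex.cosh (n * (c.1 + c.2 * Complex.I)) =
      Complex.cosh (n * (ξ + η * Complex.I)) := by
    have a := Polynomial.Chebyshev.T_complex_cosh (c.1 + c.2 * Complex.I) n
    have b := Polynomial.Chebyshev.T_complex_cosh (ξ + η * Complex.I) n
    rw [e] at a
    simpa using a.symm.trans b
  rw [cosh_nat_mul, cosh_nat_mul, Complex.mk.injEq] at e'
  exact e'

end ElectroOsmosis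

end

open ElectroOsmosis

/-!
Two solutions differ by a function that decays at infinity, has zero flux through `∂D` and matches
values and fluxes across `∂Ω`. Adding a small multiple of a subharmonic function that increases in
the outward direction at `∂D` and has a convex kink along `∂Ω` excludes every local maximum, so the
difference vanishes; hence it suffices to exhibit one solution.

In elliptic coordinates, which are the conformal map `l cosh`, the ansatz
`(A e^{nξ} + B e^{-nξ}) cos(nη - θ)` on either side of `∂Ω` turns the system into linear equations
for the coefficients. Cloaking asks that the coefficient of `e^{-nξ}` outside `Ω` be that of `P`,
shielding that `p` vanish identically inside `Ω`; each condition fixes `ζ₀`. The sine fields are the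
case `θ = π/2`.
-/

namespace ElectroOsmosis

open InnerProductSpace Laplacian

section Lines

variable {E : Type*} [NormedAddCommGroup E] [NormedSpace ℝ E]

theorem hasDerivAt_line (x v : E) (t : ℝ) : HasDerivAt (fun t : ℝ => x + t • v) v t := by
  simpa only [id_eq, one_smul] using ((hasDerivAt_id t).smul_const v).const_add x

theorem tendsto_line (x v : E) : Tendsto (fun t : ℝ => x + t • v) (𝓝 0) (𝓝 x) := by
  simpa only [ContinuousAt, zero_smul, add_zero] using (hasDerivAt_line x v 0).continuousAt

theorem tendsto_line_right (x v : E) : Tendsto (fun t : ℝ => x + t • v) (𝓝[>] 0) (𝓝 x) :=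
  (tendsto_line x v).mono_left nhdsWithin_le_nhds

theorem iteratedFDeriv_two_eq_deriv_deriv {f : E → ℝ} {x : E} (h : ContDiffAt ℝ 2 f x) (v : E) :
    iteratedFDeriv ℝ 2 f x ![v, v] = deriv (deriv fun t : ℝ => f (x + t • v)) 0 := by
  have hfst : (deriv fun t : ℝ => f (x + t • v)) =ᶠ[𝓝 0] fun t => fderiv ℝ f (x + t • v) v := by
    filter_upwards [(tendsto_line x v).eventually (h.eventually (by simp))] with t ht
    exact ((ht.differentiableAt two_ne_zero).hasFDerivAt.comp_hasDerivAt t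
      (hasDerivAt_line x v t)).deriv
  have hdiff : HasFDerivAt (fderiv ℝ f) (fderiv ℝ (fderiv ℝ f) x) (x + (0 : ℝ) • v) := by
    rw [zero_smul, add_zero]
    exact ((h.fderiv_right (m := 1) le_rfl).differentiableAt one_ne_zero).hasFDerivAt
  have hsnd : HasDerivAt (fun t : ℝ => fderiv ℝ f (x + t • v) v)
      (fderiv ℝ (fderiv ℝ f) x v v) 0 :=
    (ContinuousLinearMap.apply ℝ ℝ v).hasFDerivAt.comp_hasDerivAt (0 : ℝ)
      (hdiff.comp_hasDerivAt (0 : ℝ) (hasDerivAt_line x v 0))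
  rw [hfst.deriv_eq, hsnd.deriv, iteratedFDeriv_two_apply]
  rfl

end Lines

theorem deriv_deriv_nonpos_of_isLocalMax {f : ℝ → ℝ} {a : ℝ} (h : IsLocalMax f a)
    (hc : ContinuousAt f a) : deriv (deriv f) a ≤ 0 := by
  by_contra! hpos
  have hmin : IsLocalMin f a := isLocalMin_of_deriv_deriv_pos hpos h.deriv_eq_zero hc
  have hconst : f =ᶠ[𝓝 a] fun _ => f a := by
    filter_upwards [h, hmin] with y hy hy' using le_antisymm hy hy'
  have hderiv : deriv f =ᶠ[𝓝 a] fun _ => 0 := by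
    simpa only [deriv_const'] using hconst.deriv
  rw [hderiv.deriv_eq, deriv_const] at hpos
  exact hpos.false

theorem nonpos_of_hasDerivWithinAt_of_le {h : ℝ → ℝ} {a : ℝ}
    (hd : HasDerivWithinAt h a (Set.Ici 0) 0) (hm : ∀ᶠ t in 𝓝[>] (0 : ℝ), h t ≤ h 0) : a ≤ 0 := by
  have hslope : Tendsto (slope h 0) (𝓝[>] 0) (𝓝 a) :=
    (hasDerivWithinAt_iff_tendsto_slope' Set.self_notMem_Ioi).1 (hd.mono Set.Ioi_subset_Ici_self)
  refine le_of_tendsto hslope ?_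
  filter_upwards [hm, self_mem_nhdsWithin] with t hle ht
  rw [slope_def_field, sub_zero]
  exact div_nonpos_of_nonpos_of_nonneg (sub_nonpos.2 hle) (le_of_lt ht)

section Gradients

variable {E : Type*} [NormedAddCommGroup E] [InnerProductSpace ℝ E] [CompleteSpace E]

theorem hasDerivAt_comp_line {f : E → ℝ} {x v : E} {t : ℝ}
    (h : DifferentiableAt ℝ f (x + t • v)) :
    HasDerivAt (fun t : ℝ => f (x + t • v)) (inner ℝ (∇ f (x + t • v)) v) t := by
  rw [inner_gradient_left]
  exact h.hasFDerivAt.comp_hasDerivAt t (hasDerivAt_line x v t)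

theorem hasDerivAt_comp_line_zero {f : E → ℝ} {x : E} (h : DifferentiableAt ℝ f x) (v : E) :
    HasDerivAt (fun t : ℝ => f (x + t • v)) (inner ℝ (∇ f x) v) 0 := by
  have hx : x + (0 : ℝ) • v = x := by rw [zero_smul, add_zero]
  rw [← congrArg (∇ f) hx]
  exact hasDerivAt_comp_line (hx.symm ▸ h)

theorem eventually_neg_of_inner_gradient_neg {f : E → ℝ} {x v : E} (hf : DifferentiableAt ℝ f x)
    (hx : f x = 0) (hv : inner ℝ (∇ f x) v < 0) : ∀ᶠ t in 𝓝[>] (0 : ℝ), f (x + t • v) < 0 := by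
  have hslope := (hasDerivAt_iff_tendsto_slope.1 (hasDerivAt_comp_line_zero hf v)).mono_left
    (nhdsGT_le_nhdsNE (0 : ℝ))
  filter_upwards [hslope.eventually (eventually_lt_nhds hv), self_mem_nhdsWithin] with t hneg ht
  have ht' : (0 : ℝ) < t := ht
  rwa [slope_def_field, zero_smul, add_zero, hx, sub_zero, sub_zero, div_lt_iff₀ ht', zero_mul]
    at hneg

theorem eventually_pos_of_inner_gradient_pos {f : E → ℝ} {x v : E} (hf : DifferentiableAt ℝ f x)
    (hx : f x = 0) (hv : 0 < inner ℝ (∇ f x) v) : ∀ᶠ t in 𝓝[>] (0 : ℝ), 0 < f (x + t • v) := by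
  have hneg := eventually_neg_of_inner_gradient_neg (f := fun y => -f y) (v := v) hf.fun_neg
    (neg_eq_zero.2 hx) (by
      rw [inner_gradient_left, fderiv_fun_neg, neg_apply, ← inner_gradient_left]
      exact neg_neg_of_pos hv)
  exact hneg.mono fun t ht => neg_neg_iff_pos.1 ht

theorem hasDerivWithinAt_line_of_tendsto {f : E → ℝ} {x v : E} {a : ℝ}
    (hd : ∀ᶠ t in 𝓝[>] (0 : ℝ), DifferentiableAt ℝ f (x + t • v))
    (hc : Tendsto (fun t : ℝ => f (x + t • v)) (𝓝[>] 0) (𝓝 (f x)))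
    (ha : Tendsto (fun t : ℝ => inner ℝ (∇ f (x + t • v)) v) (𝓝[>] 0) (𝓝 a)) :
    HasDerivWithinAt (fun t : ℝ => f (x + t • v)) a (Set.Ici 0) 0 := by
  refine hasDerivWithinAt_Ici_of_tendsto_deriv
    (s := {t | 0 < t ∧ DifferentiableAt ℝ f (x + t • v)}) ?_ ?_ ?_ ?_
  · exact fun t ht => (hasDerivAt_comp_line ht.2).differentiableAt.differentiableWithinAt
  · have hright : ContinuousWithinAt (fun t : ℝ => f (x + t • v)) (Set.Ioi 0) 0 := by
      simpa only [ContinuousWithinAt, zero_smul, add_zero] using hc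
    exact hright.mono fun t ht => ht.1
  · filter_upwards [hd, self_mem_nhdsWithin] with t hdt ht using ⟨ht, hdt⟩
  · refine ha.congr' ?_
    filter_upwards [hd] with t hdt using (hasDerivAt_comp_line hdt).deriv.symm

theorem add_mul_inner_gradient_nonpos_of_le_on_ray {w b : E → ℝ} {x v : E} {a ε : ℝ}
    (hd : ∀ᶠ t in 𝓝[>] (0 : ℝ), DifferentiableAt ℝ w (x + t • v))
    (hc : Tendsto (fun t : ℝ => w (x + t • v)) (𝓝[>] 0) (𝓝 (w x)))
    (ha : Tendsto (fun t : ℝ => inner ℝ (∇ w (x + t • v)) v) (𝓝[>] 0) (𝓝 a))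
    (hb : DifferentiableAt ℝ b x)
    (hm : ∀ᶠ t in 𝓝[>] (0 : ℝ), w (x + t • v) + ε * b (x + t • v) ≤ w x + ε * b x) :
    a + ε * inner ℝ (∇ b x) v ≤ 0 := by
  refine nonpos_of_hasDerivWithinAt_of_le ((hasDerivWithinAt_line_of_tendsto hd hc ha).fun_add
    ((hasDerivAt_comp_line_zero hb v).hasDerivWithinAt.const_mul ε)) ?_
  simpa only [zero_smul, add_zero] using hm

theorem tendsto_inner_gradient {f : E → ℝ} {x : E} (hf : ContDiffAt ℝ 2 f x) (v : E) :
    Tendsto (fun y => inner ℝ (∇ f y) v) (𝓝 x) (𝓝 (inner ℝ (∇ f x) v)) := by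
  simp only [inner_gradient_left]
  exact ((hf.fderiv_right (m := 1) le_rfl).continuousAt.clm_apply continuousAt_const).tendsto

end Gradients

section LaplacianAtMaximum

variable {E : Type*} [NormedAddCommGroup E] [InnerProductSpace ℝ E] [FiniteDimensional ℝ E]

theorem laplacian_nonpos_of_isLocalMax {f : E → ℝ} {x : E} (h : ContDiffAt ℝ 2 f x)
    (hm : IsLocalMax f x) : Δ f x ≤ 0 := by
  rw [laplacian_eq_iteratedFDeriv_stdOrthonormalBasis]
  refine Finset.sum_nonpos fun i _ => ?_
  rw [iteratedFDeriv_two_eq_deriv_deriv h]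
  set v := stdOrthonormalBasis ℝ E i
  have hx : x + (0 : ℝ) • v = x := by rw [zero_smul, add_zero]
  refine deriv_deriv_nonpos_of_isLocalMax ?_ ?_
  · filter_upwards [(tendsto_line x v).eventually hm] with t ht
    rwa [hx]
  · rw [ContinuousAt, hx]
    exact h.continuousAt.tendsto.comp (tendsto_line x v)

theorem not_isLocalMax_of_laplacian_pos {f : E → ℝ} {x : E} (h : ContDiffAt ℝ 2 f x)
    (hpos : 0 < Δ f x) : ¬ IsLocalMax f x :=
  fun hm => hpos.not_ge (laplacian_nonpos_of_isLocalMax h hm)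

end LaplacianAtMaximum

/-! ### Maximum principles -/

theorem nonpos_of_forall_not_isLocalMaxOn {X : Type*} [TopologicalSpace X] {K : Set X}
    {w g : X → ℝ} (hK : IsClosed K) (hw : ContinuousOn w K) (hg : ContinuousOn g K)
    (hinf : Tendsto w (cocompact X) (𝓝 0))
    (hmax : ∀ ε : ℝ, 0 < ε → ∀ x ∈ K, ¬ IsLocalMaxOn (w + ε • g) K x) {x : X} (hx : x ∈ K) :
    w x ≤ 0 := by
  by_contra! hpos
  obtain ⟨δ, hδ0, hδ⟩ : ∃ δ : ℝ, 0 < δ ∧ w x = δ + δ :=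
    ⟨w x / 2, half_pos hpos, (add_halves _).symm⟩
  set K' : Set X := K ∩ w ⁻¹' Set.Ici δ
  have hcompact : IsCompact K' := by
    obtain ⟨C, hC, hCw⟩ := mem_cocompact.1 (hinf.eventually (eventually_lt_nhds hδ0))
    refine hC.of_isClosed_subset (hw.preimage_isClosed_of_isClosed hK isClosed_Ici) fun y hy => ?_
    by_contra hyC
    have hyδ : δ ≤ w y := hy.2
    exact hyδ.not_gt (hCw hyC)
  have hxK' : x ∈ K' := ⟨hx, show δ ≤ w x by linarith⟩
  obtain ⟨M, hM⟩ := hcompact.exists_bound_of_continuousOn (hg.mono Set.inter_subset_left)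
  have hM0 : 0 ≤ M := (norm_nonneg _).trans (hM x hxK')
  obtain ⟨ε, hε, hεM⟩ : ∃ ε : ℝ, 0 < ε ∧ ε * (2 * M) < δ :=
    ⟨δ / (2 * M + 1), by positivity, by
      rw [div_mul_eq_mul_div, div_lt_iff₀ (by positivity)]
      nlinarith⟩
  obtain ⟨m, hmK', hm⟩ := hcompact.exists_isMaxOn ⟨x, hxK'⟩
    ((hw.add (hg.const_smul ε)).mono Set.inter_subset_left)
  have hδm : δ < w m := by
    have hle : w x + ε * g x ≤ w m + ε * g m := hm hxK'
    have hgx := mul_le_mul_of_nonneg_left (neg_le_of_abs_le (hM x hxK')) hε.le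
    have hgm := mul_le_mul_of_nonneg_left (le_of_abs_le (hM m hmK')) hε.le
    linarith
  refine hmax ε hε m hmK'.1 ?_
  filter_upwards [(hw m hmK'.1).eventually (eventually_gt_nhds hδm), self_mem_nhdsWithin]
    with y hy hyK using hm ⟨hyK, hy.le⟩

theorem not_isLocalMax_add_smul_of_harmonicAt {E : Type*} [NormedAddCommGroup E]
    [InnerProductSpace ℝ E] [FiniteDimensional ℝ E] {w g : E → ℝ} {x : E} {ε : ℝ}
    (hw : HarmonicAt w x) (hg : ContDiffAt ℝ 2 g x) (hpos : 0 < Δ g x) (hε : 0 < ε) :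
    ¬ IsLocalMax (w + ε • g) x := by
  have hεg : ContDiffAt ℝ 2 (ε • g) x := hg.const_smul ε
  refine not_isLocalMax_of_laplacian_pos (hw.1.add hεg) ?_
  rw [hw.1.laplacian_add hεg, hw.2.self_of_nhds, laplacian_smul _ hg, Pi.zero_apply, zero_add]
  exact mul_pos hε hpos

/-! ### Domains with a subharmonic defining function -/

theorem IsOutwardUnitNormal.eq {U : Set Plane} {x ν₁ ν₂ : Plane}
    (h₁ : IsOutwardUnitNormal U x ν₁) (h₂ : IsOutwardUnitNormal U x ν₂) : ν₁ = ν₂ := by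
  obtain ⟨hν₁, ρ₁, hd₁, hx₁, ⟨c₁, hc₁, hgrad₁⟩, hU₁⟩ := h₁
  obtain ⟨hν₂, ρ₂, hd₂, hx₂, ⟨c₂, hc₂, hgrad₂⟩, hU₂⟩ := h₂
  by_contra hne
  have hlt : inner ℝ ν₁ ν₂ < 1 := (inner_lt_one_iff_real_of_norm_eq_one hν₁ hν₂).2 hne
  have hneg := eventually_neg_of_inner_gradient_neg (v := ν₂ - ν₁)
    (hd₁.differentiableAt one_ne_zero) hx₁ (by
      rw [hgrad₁, real_inner_smul_left, inner_sub_right, real_inner_self_eq_norm_sq, hν₁]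
      exact mul_neg_of_pos_of_neg hc₁ (by linarith))
  have hpos := eventually_pos_of_inner_gradient_pos (v := ν₂ - ν₁)
    (hd₂.differentiableAt one_ne_zero) hx₂ (by
      rw [hgrad₂, real_inner_smul_left, inner_sub_right, real_inner_self_eq_norm_sq, hν₂,
        real_inner_comm]
      exact mul_pos hc₂ (by linarith))
  obtain ⟨t, ht₁, ht₂, hU⟩ := (hneg.and (hpos.and
    ((tendsto_line_right x (ν₂ - ν₁)).eventually (hU₁.and hU₂)))).exists
  exact ht₂.not_gt (hU.2.1 (hU.1.2 ht₁))

theorem outwardNormal_eq {U : Set Plane} {x ν : Plane} (h : IsOutwardUnitNormal U x ν) :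
    outwardNormal U x = ν := by
  have hex : ∃ ν, IsOutwardUnitNormal U x ν := ⟨ν, h⟩
  rw [outwardNormal, dif_pos hex]
  exact hex.choose_spec.eq h

/-- `U = {ρ < 0}` for a `C²` function `ρ` that is strictly subharmonic in the whole plane and has no
critical point on its zero set. Such functions serve as barriers in the maximum principle. -/
structure IsSubharmonicDefiningFunction (ρ : Plane → ℝ) (U : Set Plane) : Prop where
  contDiff : ContDiff ℝ 2 ρ
  laplacian_pos : ∀ x, 0 < Δ ρ x
  gradient_ne_zero : ∀ x, ρ x = 0 → ∇ ρ x ≠ 0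
  mem_iff : ∀ x, x ∈ U ↔ ρ x < 0

namespace IsSubharmonicDefiningFunction

variable {ρ : Plane → ℝ} {U : Set Plane}

theorem differentiableAt (h : IsSubharmonicDefiningFunction ρ U) (x : Plane) :
    DifferentiableAt ℝ ρ x :=
  h.contDiff.differentiable two_ne_zero x

theorem mem_closure_iff (h : IsSubharmonicDefiningFunction ρ U) {x : Plane} :
    x ∈ closure U ↔ ρ x ≤ 0 := by
  have hU : U = {y | ρ y < 0} := Set.ext h.mem_iff
  refine ⟨fun hx => closure_lt_subset_le h.contDiff.continuous continuous_const (hU ▸ hx),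
    fun hx => ?_⟩
  rcases hx.lt_or_eq with hx | hx
  · exact subset_closure ((h.mem_iff x).2 hx)
  · have hinward : inner ℝ (∇ ρ x) (-∇ ρ x) < 0 := by
      rw [inner_neg_right, neg_neg_iff_pos]
      exact real_inner_self_pos.2 (h.gradient_ne_zero x hx)
    exact mem_closure_of_tendsto (tendsto_line_right x (-∇ ρ x))
      ((eventually_neg_of_inner_gradient_neg (h.differentiableAt x) hx hinward).mono
        fun t ht => (h.mem_iff _).2 ht)

theorem isOpen (h : IsSubharmonicDefiningFunction ρ U) : IsOpen U := by
  rw [show U = {y | ρ y < 0} from Set.ext h.mem_iff]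
  exact isOpen_lt h.contDiff.continuous continuous_const

theorem mem_frontier_iff (h : IsSubharmonicDefiningFunction ρ U) {x : Plane} :
    x ∈ frontier U ↔ ρ x = 0 := by
  rw [h.isOpen.frontier_eq, Set.mem_sdiff, h.mem_closure_iff, h.mem_iff, not_lt, le_antisymm_iff]

theorem notMem_frontier_of_mem (h : IsSubharmonicDefiningFunction ρ U) {x : Plane} (hx : x ∈ U) :
    x ∉ frontier U :=
  fun hf => ((h.mem_iff x).1 hx).ne (h.mem_frontier_iff.1 hf)

theorem isOutwardUnitNormal (h : IsSubharmonicDefiningFunction ρ U) {x : Plane}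
    (hx : x ∈ frontier U) : IsOutwardUnitNormal U x (‖∇ ρ x‖⁻¹ • ∇ ρ x) := by
  have hρx := h.mem_frontier_iff.1 hx
  have hnorm : ‖∇ ρ x‖ ≠ 0 := norm_ne_zero_iff.2 (h.gradient_ne_zero x hρx)
  refine ⟨?_, ρ, h.contDiff.contDiffAt.of_le one_le_two, hρx,
    ⟨‖∇ ρ x‖, norm_pos_iff.2 (h.gradient_ne_zero x hρx), ?_⟩, .of_forall h.mem_iff⟩
  · rw [norm_smul, norm_inv, norm_norm, inv_mul_cancel₀ hnorm]
  · rw [smul_inv_smul₀ hnorm]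

theorem inner_gradient_outwardNormal_pos (h : IsSubharmonicDefiningFunction ρ U) {x : Plane}
    (hx : x ∈ frontier U) : 0 < inner ℝ (∇ ρ x) (outwardNormal U x) := by
  have hgrad : ∇ ρ x ≠ 0 := h.gradient_ne_zero x (h.mem_frontier_iff.1 hx)
  rw [outwardNormal_eq (h.isOutwardUnitNormal hx), real_inner_smul_right]
  exact mul_pos (inv_pos.2 (norm_pos_iff.2 hgrad)) (real_inner_self_pos.2 hgrad)

theorem eventually_add_outwardNormal_notMem_closure (h : IsSubharmonicDefiningFunction ρ U)
    {x : Plane} (hx : x ∈ frontier U) :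
    ∀ᶠ t in 𝓝[>] (0 : ℝ), x + t • outwardNormal U x ∉ closure U :=
  (eventually_pos_of_inner_gradient_pos (h.differentiableAt x) (h.mem_frontier_iff.1 hx)
    (h.inner_gradient_outwardNormal_pos hx)).mono
    fun _ ht hmem => ht.not_ge (h.mem_closure_iff.1 hmem)

theorem eventually_add_neg_outwardNormal_mem (h : IsSubharmonicDefiningFunction ρ U)
    {x : Plane} (hx : x ∈ frontier U) :
    ∀ᶠ t in 𝓝[>] (0 : ℝ), x + t • -outwardNormal U x ∈ U :=
  (eventually_neg_of_inner_gradient_neg (h.differentiableAt x) (h.mem_frontier_iff.1 hx)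
    (by
      rw [inner_neg_right]
      exact neg_neg_of_pos (h.inner_gradient_outwardNormal_pos hx))).mono
    fun t ht => (h.mem_iff _).2 ht

end IsSubharmonicDefiningFunction

theorem HasInnerNormalDeriv.tendsto_neg {U : Set Plane} {f : Plane → ℝ} {x : Plane} {a : ℝ}
    (h : HasInnerNormalDeriv U f x a) :
    Tendsto (fun t : ℝ => inner ℝ (∇ f (x + t • -outwardNormal U x)) (-outwardNormal U x))
      (𝓝[>] 0) (𝓝 (-a)) := by
  simpa only [inner_neg_right, smul_neg, ← sub_eq_add_neg] using Tendsto.neg h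

theorem HasOuterNormalDeriv.neg {U : Set Plane} {f : Plane → ℝ} {x : Plane} {a : ℝ}
    (h : HasOuterNormalDeriv U f x a) : HasOuterNormalDeriv U (-f) x (-a) := by
  simpa only [HasOuterNormalDeriv, inner_gradient_left, fderiv_neg, neg_apply] using Tendsto.neg h

theorem HasInnerNormalDeriv.neg {U : Set Plane} {f : Plane → ℝ} {x : Plane} {a : ℝ}
    (h : HasInnerNormalDeriv U f x a) : HasInnerNormalDeriv U (-f) x (-a) := by
  simpa only [HasInnerNormalDeriv, inner_gradient_left, fderiv_neg, neg_apply] using Tendsto.neg h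

theorem HasOuterNormalDeriv.sub {U : Set Plane} {f g : Plane → ℝ} {x : Plane} {a b : ℝ}
    (hf : HasOuterNormalDeriv U f x a) (hg : HasOuterNormalDeriv U g x b)
    (hdf : ∀ᶠ t in 𝓝[>] (0 : ℝ), DifferentiableAt ℝ f (x + t • outwardNormal U x))
    (hdg : ∀ᶠ t in 𝓝[>] (0 : ℝ), DifferentiableAt ℝ g (x + t • outwardNormal U x)) :
    HasOuterNormalDeriv U (f - g) x (a - b) := by
  refine (Tendsto.sub hf hg).congr' ?_
  filter_upwards [hdf, hdg] with t htf htg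
  simp only [inner_gradient_left, fderiv_sub htf htg, sub_apply]

theorem HasInnerNormalDeriv.sub {U : Set Plane} {f g : Plane → ℝ} {x : Plane} {a b : ℝ}
    (hf : HasInnerNormalDeriv U f x a) (hg : HasInnerNormalDeriv U g x b)
    (hdf : ∀ᶠ t in 𝓝[>] (0 : ℝ), DifferentiableAt ℝ f (x + t • -outwardNormal U x))
    (hdg : ∀ᶠ t in 𝓝[>] (0 : ℝ), DifferentiableAt ℝ g (x + t • -outwardNormal U x)) :
    HasInnerNormalDeriv U (f - g) x (a - b) := by
  refine (Tendsto.sub hf hg).congr' ?_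
  filter_upwards [hdf, hdg] with t htf htg
  rw [smul_neg, ← sub_eq_add_neg] at htf htg
  simp only [inner_gradient_left, fderiv_sub htf htg, sub_apply]

theorem HasOuterNormalDeriv.of_eventuallyEq {U : Set Plane} {f g : Plane → ℝ} {x : Plane}
    (hf : ContDiffAt ℝ 2 f x)
    (hg : ∀ᶠ t in 𝓝[>] (0 : ℝ), g =ᶠ[𝓝 (x + t • outwardNormal U x)] f) :
    HasOuterNormalDeriv U g x (inner ℝ (∇ f x) (outwardNormal U x)) := by
  refine ((tendsto_inner_gradient hf _).comp (tendsto_line_right x (outwardNormal U x))).congr' ?_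
  filter_upwards [hg] with t ht
  rw [Function.comp_apply, ht.gradient_eq]

theorem HasInnerNormalDeriv.of_eventuallyEq {U : Set Plane} {f g : Plane → ℝ} {x : Plane}
    (hf : ContDiffAt ℝ 2 f x)
    (hg : ∀ᶠ t in 𝓝[>] (0 : ℝ), g =ᶠ[𝓝 (x + t • -outwardNormal U x)] f) :
    HasInnerNormalDeriv U g x (inner ℝ (∇ f x) (outwardNormal U x)) := by
  refine ((tendsto_inner_gradient hf _).comp (tendsto_line_right x (-outwardNormal U x))).congr' ?_
  filter_upwards [hg] with t ht
  rw [Function.comp_apply, ← ht.gradient_eq, smul_neg, ← sub_eq_add_neg]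

/-! ### Uniqueness for the exterior transmission problem -/

/-- The barrier of the maximum principle: a strictly subharmonic function with a convex kink across
the curve `ρ = 0`. -/
def kinkBarrier (σ ρ : Plane → ℝ) (x : Plane) : ℝ := σ x + max 0 (ρ x)

/-- `w` solves the exterior Neumann problem outside `D`, with transmission across the boundary of
`Ω`, for zero data. -/
structure IsHomogeneousSolution (D Ω : Set Plane) (w : Plane → ℝ) : Prop where
  cont : ContinuousOn w Dᶜ
  harmonic : HarmonicOnNhd w ((closure D)ᶜ \ frontier Ω)
  neumann : ∀ x ∈ frontier D, HasOuterNormalDeriv D w x 0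
  transmission : ∀ x ∈ frontier Ω, ∃ a, HasOuterNormalDeriv Ω w x a ∧ HasInnerNormalDeriv Ω w x a
  tendsto_zero : Tendsto w (cocompact Plane) (𝓝 0)

theorem kinkBarrier_of_nonpos {σ ρ : Plane → ℝ} {x : Plane} (h : ρ x ≤ 0) :
    kinkBarrier σ ρ x = σ x := by
  rw [kinkBarrier, max_eq_left h, add_zero]

theorem kinkBarrier_of_nonneg {σ ρ : Plane → ℝ} {x : Plane} (h : 0 ≤ ρ x) :
    kinkBarrier σ ρ x = (σ + ρ) x := by
  rw [kinkBarrier, max_eq_right h, Pi.add_apply]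

theorem notMem_closure_of_mem_frontier {X : Type*} [TopologicalSpace X] {D Ω : Set X} {x : X}
    (hΩ : IsOpen Ω) (hDΩ : closure D ⊆ Ω) (hx : x ∈ frontier Ω) : x ∉ closure D :=
  fun hmem => (hΩ.frontier_eq ▸ hx).2 (hDΩ hmem)

section Uniqueness

variable {D Ω : Set Plane} {σ ρ w : Plane → ℝ} {x : Plane} {ε : ℝ}

theorem contDiffAt_kinkBarrier_and_laplacian_pos (hσ : IsSubharmonicDefiningFunction σ D)
    (hρ : IsSubharmonicDefiningFunction ρ Ω) (hx : x ∉ frontier Ω) :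
    ContDiffAt ℝ 2 (kinkBarrier σ ρ) x ∧ 0 < Δ (kinkBarrier σ ρ) x := by
  have hσx : ContDiffAt ℝ 2 σ x := hσ.contDiff.contDiffAt
  have hρx : ContDiffAt ℝ 2 ρ x := hρ.contDiff.contDiffAt
  rcases lt_or_gt_of_ne (hρ.mem_frontier_iff.not.1 hx) with hneg | hpos
  · have heq : kinkBarrier σ ρ =ᶠ[𝓝 x] σ := by
      filter_upwards [hρx.continuousAt.eventually (eventually_lt_nhds hneg)] with y hy
        using kinkBarrier_of_nonpos hy.le
    exact ⟨hσx.congr_of_eventuallyEq heq, (laplacian_congr_nhds heq).self_of_nhds ▸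
      hσ.laplacian_pos x⟩
  · have heq : kinkBarrier σ ρ =ᶠ[𝓝 x] σ + ρ := by
      filter_upwards [hρx.continuousAt.eventually (eventually_gt_nhds hpos)] with y hy
        using kinkBarrier_of_nonneg hy.le
    refine ⟨(hσx.add hρx).congr_of_eventuallyEq heq, ?_⟩
    rw [(laplacian_congr_nhds heq).self_of_nhds, hσx.laplacian_add hρx]
    exact add_pos (hσ.laplacian_pos x) (hρ.laplacian_pos x)

namespace IsHomogeneousSolution

theorem differentiableAt (hw : IsHomogeneousSolution D Ω w) (hD : x ∉ closure D)
    (hΩ : x ∉ frontier Ω) : DifferentiableAt ℝ w x :=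
  (hw.harmonic x ⟨hD, hΩ⟩).1.differentiableAt two_ne_zero

theorem neg (hw : IsHomogeneousSolution D Ω w) : IsHomogeneousSolution D Ω (-w) where
  cont := hw.cont.neg
  harmonic := hw.harmonic.neg
  neumann x hx := by simpa only [neg_zero] using (hw.neumann x hx).neg
  transmission x hx := by
    obtain ⟨a, ha, hb⟩ := hw.transmission x hx
    exact ⟨-a, ha.neg, hb.neg⟩
  tendsto_zero := neg_zero (G := ℝ) ▸ hw.tendsto_zero.neg

/-- Moving into the exterior, the barrier strictly increases while `w` is stationary to first
order. -/
theorem not_isLocalMaxOn_of_mem_frontier_left (hw : IsHomogeneousSolution D Ω w)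
    (hσ : IsSubharmonicDefiningFunction σ D) (hρ : IsSubharmonicDefiningFunction ρ Ω)
    (hDΩ : closure D ⊆ Ω) (hε : 0 < ε) (hx : x ∈ frontier D) :
    ¬ IsLocalMaxOn (w + ε • kinkBarrier σ ρ) Dᶜ x := by
  intro hmax
  set ν := outwardNormal D x
  have hxΩ : x ∈ Ω := hDΩ (frontier_subset_closure hx)
  have hD := hσ.eventually_add_outwardNormal_notMem_closure hx
  have hΩ : ∀ᶠ t in 𝓝[>] (0 : ℝ), x + t • ν ∈ Ω :=
    (tendsto_line_right x ν).eventually (hρ.isOpen.mem_nhds hxΩ)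
  have hray : Tendsto (fun t : ℝ => x + t • ν) (𝓝[>] 0) (𝓝[Dᶜ] x) :=
    tendsto_nhdsWithin_iff.2 ⟨tendsto_line_right x ν, hD.mono fun t ht hmem =>
      ht (subset_closure hmem)⟩
  have hle : 0 + ε * inner ℝ (∇ σ x) ν ≤ 0 := by
    refine add_mul_inner_gradient_nonpos_of_le_on_ray ?_
      ((hw.cont x (hσ.isOpen.frontier_eq ▸ hx).2).tendsto.comp hray) (hw.neumann x hx)
      (hσ.differentiableAt x) ?_
    · filter_upwards [hD, hΩ] with t htD htΩ using
        hw.differentiableAt htD (hρ.notMem_frontier_of_mem htΩ)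
    · filter_upwards [hray.eventually hmax, hΩ] with t ht htΩ
      rw [← kinkBarrier_of_nonpos (σ := σ) ((hρ.mem_iff x).1 hxΩ).le,
        ← kinkBarrier_of_nonpos (σ := σ) ((hρ.mem_iff _).1 htΩ).le]
      exact ht
  have hincrease := mul_pos hε (hσ.inner_gradient_outwardNormal_pos hx)
  linarith

/-- The derivatives of `w` along `ν` and `-ν` cancel, those of the barrier add up to the size of the
kink. -/
theorem not_isLocalMax_of_mem_frontier_right (hw : IsHomogeneousSolution D Ω w)
    (hσ : IsSubharmonicDefiningFunction σ D) (hρ : IsSubharmonicDefiningFunction ρ Ω)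
    (hDΩ : closure D ⊆ Ω) (hε : 0 < ε) (hx : x ∈ frontier Ω) :
    ¬ IsLocalMax (w + ε • kinkBarrier σ ρ) x := by
  intro hmax
  obtain ⟨a, houter, hinner⟩ := hw.transmission x hx
  set ν := outwardNormal Ω x
  have hρx : ρ x = 0 := hρ.mem_frontier_iff.1 hx
  have hxD : (closure D)ᶜ ∈ 𝓝 x := isClosed_closure.isOpen_compl.mem_nhds
    (notMem_closure_of_mem_frontier hρ.isOpen hDΩ hx)
  have hcont : ContinuousAt w x :=
    hw.cont.continuousAt (mem_of_superset hxD (Set.compl_subset_compl.2 subset_closure))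
  have hD : ∀ v : Plane, ∀ᶠ t in 𝓝[>] (0 : ℝ), x + t • v ∉ closure D := fun v =>
    (tendsto_line_right x v).eventually hxD
  have hout := hρ.eventually_add_outwardNormal_notMem_closure hx
  have hin := hρ.eventually_add_neg_outwardNormal_mem hx
  have hle_out : a + ε * inner ℝ (∇ (σ + ρ) x) ν ≤ 0 := by
    refine add_mul_inner_gradient_nonpos_of_le_on_ray ?_
      (hcont.tendsto.comp (tendsto_line_right x ν)) houter
      ((hσ.differentiableAt x).add (hρ.differentiableAt x)) ?_
    · filter_upwards [hD ν, hout] with t htD ht using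
        hw.differentiableAt htD fun hmem => ht (frontier_subset_closure hmem)
    · filter_upwards [(tendsto_line_right x ν).eventually hmax, hout] with t ht htΩ
      rw [← kinkBarrier_of_nonneg hρx.ge,
        ← kinkBarrier_of_nonneg (not_le.1 (hρ.mem_closure_iff.not.1 htΩ)).le]
      exact ht
  have hle_in : -a + ε * inner ℝ (∇ σ x) (-ν) ≤ 0 := by
    refine add_mul_inner_gradient_nonpos_of_le_on_ray ?_
      (hcont.tendsto.comp (tendsto_line_right x (-ν))) hinner.tendsto_neg
      (hσ.differentiableAt x) ?_
    · filter_upwards [hD (-ν), hin] with t htD ht using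
        hw.differentiableAt htD (hρ.notMem_frontier_of_mem ht)
    · filter_upwards [(tendsto_line_right x (-ν)).eventually hmax, hin] with t ht htΩ
      rw [← kinkBarrier_of_nonpos (σ := σ) hρx.le,
        ← kinkBarrier_of_nonpos (σ := σ) ((hρ.mem_iff _).1 htΩ).le]
      exact ht
  rw [inner_gradient_left, fderiv_add (hσ.differentiableAt x) (hρ.differentiableAt x), add_apply,
    ← inner_gradient_left, ← inner_gradient_left] at hle_out
  rw [inner_neg_right] at hle_in
  have hkink := mul_pos hε (hρ.inner_gradient_outwardNormal_pos hx)
  linarith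

theorem not_isLocalMaxOn (hw : IsHomogeneousSolution D Ω w)
    (hσ : IsSubharmonicDefiningFunction σ D) (hρ : IsSubharmonicDefiningFunction ρ Ω)
    (hDΩ : closure D ⊆ Ω) (hε : 0 < ε) (hx : x ∈ Dᶜ) :
    ¬ IsLocalMaxOn (w + ε • kinkBarrier σ ρ) Dᶜ x := by
  by_cases hD : x ∈ closure D
  · exact hw.not_isLocalMaxOn_of_mem_frontier_left hσ hρ hDΩ hε (hσ.isOpen.frontier_eq ▸ ⟨hD, hx⟩)
  have hnhds : Dᶜ ∈ 𝓝 x := mem_of_superset (isClosed_closure.isOpen_compl.mem_nhds hD)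
    (Set.compl_subset_compl.2 subset_closure)
  intro hmax
  have hmax' : IsLocalMax (w + ε • kinkBarrier σ ρ) x := hmax.isLocalMax hnhds
  by_cases hΩ : x ∈ frontier Ω
  · exact hw.not_isLocalMax_of_mem_frontier_right hσ hρ hDΩ hε hΩ hmax'
  · obtain ⟨hdiff, hpos⟩ := contDiffAt_kinkBarrier_and_laplacian_pos hσ hρ hΩ
    exact not_isLocalMax_add_smul_of_harmonicAt (hw.harmonic x ⟨hD, hΩ⟩) hdiff hpos hε hmax'

theorem nonpos (hw : IsHomogeneousSolution D Ω w)
    (hσ : IsSubharmonicDefiningFunction σ D) (hρ : IsSubharmonicDefiningFunction ρ Ω)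
    (hDΩ : closure D ⊆ Ω) (hx : x ∈ Dᶜ) : w x ≤ 0 :=
  nonpos_of_forall_not_isLocalMaxOn (g := kinkBarrier σ ρ) hσ.isOpen.isClosed_compl hw.cont
    (hσ.contDiff.continuous.add (continuous_const.max hρ.contDiff.continuous)).continuousOn
    hw.tendsto_zero (fun _ hε _ hy => hw.not_isLocalMaxOn hσ hρ hDΩ hε hy) hx

theorem eq_zero (hw : IsHomogeneousSolution D Ω w)
    (hσ : IsSubharmonicDefiningFunction σ D) (hρ : IsSubharmonicDefiningFunction ρ Ω)
    (hDΩ : closure D ⊆ Ω) (hx : x ∈ Dᶜ) : w x = 0 :=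
  le_antisymm (hw.nonpos hσ hρ hDΩ hx) (neg_nonpos.1 (hw.neg.nonpos hσ hρ hDΩ hx))

end IsHomogeneousSolution

end Uniqueness

theorem tendsto_zero_of_isBigO_inv_norm {f : Plane → ℝ}
    (h : f =O[Bornology.cobounded Plane] fun x => ‖x‖⁻¹) : Tendsto f (cocompact Plane) (𝓝 0) := by
  rw [← Metric.cobounded_eq_cocompact]
  exact h.trans_tendsto (tendsto_inv_atTop_zero.comp tendsto_norm_cobounded_atTop)

theorem tendsto_sub_of_isBigO_inv_norm {f g h : Plane → ℝ}
    (hf : (fun x => f x - h x) =O[Bornology.cobounded Plane] fun x => ‖x‖⁻¹)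
    (hg : (fun x => g x - h x) =O[Bornology.cobounded Plane] fun x => ‖x‖⁻¹) :
    Tendsto (f - g) (cocompact Plane) (𝓝 0) :=
  tendsto_zero_of_isBigO_inv_norm ((hf.sub hg).congr_left fun _ => sub_sub_sub_cancel_right _ _ _)

namespace IsSolution

variable {D Ω : Set Plane} {σ ρ H P φ p φ₁ p₁ φ₂ p₂ : Plane → ℝ} {ζ₀ : ℝ} {x : Plane}

theorem differentiableAt_phi (h : IsSolution D Ω ζ₀ H P φ p) (hx : x ∉ closure D) :
    DifferentiableAt ℝ φ x :=
  (h.phi_harmonic x hx).1.differentiableAt two_ne_zero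

theorem differentiableAt_p (h : IsSolution D Ω ζ₀ H P φ p) (hD : x ∉ closure D)
    (hΩ : x ∉ frontier Ω) : DifferentiableAt ℝ p x :=
  (h.p_harmonic x ⟨hD, hΩ⟩).1.differentiableAt two_ne_zero

theorem isHomogeneousSolution_phi_sub (h₁ : IsSolution D Ω ζ₀ H P φ₁ p₁)
    (h₂ : IsSolution D Ω ζ₀ H P φ₂ p₂) (hσ : IsSubharmonicDefiningFunction σ D)
    (hρ : IsSubharmonicDefiningFunction ρ Ω) (hDΩ : closure D ⊆ Ω) :
    IsHomogeneousSolution D Ω (φ₁ - φ₂) where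
  cont := h₁.phi_cont.sub h₂.phi_cont
  harmonic := (h₁.phi_harmonic.sub h₂.phi_harmonic).mono Set.sdiff_subset
  neumann x hx := by
    have hout := hσ.eventually_add_outwardNormal_notMem_closure hx
    simpa only [sub_zero] using (h₁.phi_neumann x hx).sub (h₂.phi_neumann x hx)
      (hout.mono fun _ => h₁.differentiableAt_phi) (hout.mono fun _ => h₂.differentiableAt_phi)
  transmission x hx := by
    have hsmooth := ((h₁.phi_harmonic.sub h₂.phi_harmonic) x
      (notMem_closure_of_mem_frontier hρ.isOpen hDΩ hx)).1
    exact ⟨_, .of_eventuallyEq hsmooth (.of_forall fun _ => .rfl),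
      .of_eventuallyEq hsmooth (.of_forall fun _ => .rfl)⟩
  tendsto_zero := tendsto_sub_of_isBigO_inv_norm h₁.phi_infty h₂.phi_infty

theorem phi_eq (h₁ : IsSolution D Ω ζ₀ H P φ₁ p₁) (h₂ : IsSolution D Ω ζ₀ H P φ₂ p₂)
    (hσ : IsSubharmonicDefiningFunction σ D) (hρ : IsSubharmonicDefiningFunction ρ Ω)
    (hDΩ : closure D ⊆ Ω) (hx : x ∈ Dᶜ) : φ₁ x = φ₂ x :=
  sub_eq_zero.1 ((h₁.isHomogeneousSolution_phi_sub h₂ hσ hρ hDΩ).eq_zero hσ hρ hDΩ hx)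

theorem gradient_phi_eq (h₁ : IsSolution D Ω ζ₀ H P φ₁ p₁) (h₂ : IsSolution D Ω ζ₀ H P φ₂ p₂)
    (hσ : IsSubharmonicDefiningFunction σ D) (hρ : IsSubharmonicDefiningFunction ρ Ω)
    (hDΩ : closure D ⊆ Ω) (hx : x ∉ closure D) : ∇ φ₁ x = ∇ φ₂ x := by
  refine EventuallyEq.gradient_eq ?_
  filter_upwards [isClosed_closure.isOpen_compl.mem_nhds hx] with y hy
    using h₁.phi_eq h₂ hσ hρ hDΩ fun hyD => hy (subset_closure hyD)

theorem isHomogeneousSolution_p_sub (h₁ : IsSolution D Ω ζ₀ H P φ₁ p₁)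
    (h₂ : IsSolution D Ω ζ₀ H P φ₂ p₂) (hσ : IsSubharmonicDefiningFunction σ D)
    (hρ : IsSubharmonicDefiningFunction ρ Ω) (hDΩ : closure D ⊆ Ω) :
    IsHomogeneousSolution D Ω (p₁ - p₂) where
  cont := h₁.p_cont.sub h₂.p_cont
  harmonic := h₁.p_harmonic.sub h₂.p_harmonic
  neumann x hx := by
    have hout : ∀ᶠ t in 𝓝[>] (0 : ℝ), x + t • outwardNormal D x ∉ closure D ∧
        x + t • outwardNormal D x ∉ frontier Ω :=
      (hσ.eventually_add_outwardNormal_notMem_closure hx).and <|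
        ((tendsto_line_right x _).eventually (hρ.isOpen.mem_nhds
          (hDΩ (frontier_subset_closure hx)))).mono fun _ => hρ.notMem_frontier_of_mem
    simpa only [sub_zero] using (h₁.p_neumann x hx).sub (h₂.p_neumann x hx)
      (hout.mono fun _ ht => h₁.differentiableAt_p ht.1 ht.2)
      (hout.mono fun _ ht => h₂.differentiableAt_p ht.1 ht.2)
  transmission x hx := by
    have hxD : x ∉ closure D := notMem_closure_of_mem_frontier hρ.isOpen hDΩ hx
    have hD : ∀ v : Plane, ∀ᶠ t in 𝓝[>] (0 : ℝ), x + t • v ∉ closure D := fun v =>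
      (tendsto_line_right x v).eventually (isClosed_closure.isOpen_compl.mem_nhds hxD)
    have hout := (hD (outwardNormal Ω x)).and
      ((hρ.eventually_add_outwardNormal_notMem_closure hx).mono
        fun _ ht hf => ht (frontier_subset_closure hf))
    have hin := (hD (-outwardNormal Ω x)).and ((hρ.eventually_add_neg_outwardNormal_mem hx).mono
      fun _ => hρ.notMem_frontier_of_mem)
    obtain ⟨a₁, b₁, ha₁, hb₁, hjump₁⟩ := h₁.p_jump x hx
    obtain ⟨a₂, b₂, ha₂, hb₂, hjump₂⟩ := h₂.p_jump x hx
    have heq : b₁ - b₂ = a₁ - a₂ := by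
      rw [h₁.gradient_phi_eq h₂ hσ hρ hDΩ hxD] at hjump₁
      linarith
    exact ⟨a₁ - a₂, ha₁.sub ha₂ (hout.mono fun _ ht => h₁.differentiableAt_p ht.1 ht.2)
      (hout.mono fun _ ht => h₂.differentiableAt_p ht.1 ht.2),
      heq ▸ hb₁.sub hb₂ (hin.mono fun _ ht => h₁.differentiableAt_p ht.1 ht.2)
        (hin.mono fun _ ht => h₂.differentiableAt_p ht.1 ht.2)⟩
  tendsto_zero := tendsto_sub_of_isBigO_inv_norm h₁.p_infty h₂.p_infty

theorem p_eq (h₁ : IsSolution D Ω ζ₀ H P φ₁ p₁) (h₂ : IsSolution D Ω ζ₀ H P φ₂ p₂)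
    (hσ : IsSubharmonicDefiningFunction σ D) (hρ : IsSubharmonicDefiningFunction ρ Ω)
    (hDΩ : closure D ⊆ Ω) (hx : x ∈ Dᶜ) : p₁ x = p₂ x :=
  sub_eq_zero.1 ((h₁.isHomogeneousSolution_p_sub h₂ hσ hρ hDΩ).eq_zero hσ hρ hDΩ hx)

theorem isPerfectCloaking (h : IsSolution D Ω ζ₀ H P φ p)
    (hσ : IsSubharmonicDefiningFunction σ D) (hρ : IsSubharmonicDefiningFunction ρ Ω)
    (hDΩ : closure D ⊆ Ω) (hp : ∀ x ∉ closure Ω, p x = P x) :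
    IsPerfectCloaking D Ω ζ₀ H P := by
  refine ⟨⟨φ, p, h⟩, fun φ' p' h' x hx => ?_⟩
  have hzeta : zetaMean D Ω ζ₀ x = 0 :=
    Set.indicator_of_notMem (fun hmem => hx (subset_closure hmem.1)) _
  have hgrad : ∇ p' x = ∇ P x := by
    refine EventuallyEq.gradient_eq ?_
    filter_upwards [isClosed_closure.isOpen_compl.mem_nhds hx] with y hy
    have hyD : y ∈ Dᶜ := fun hmem => hy (subset_closure (hDΩ (subset_closure hmem)))
    exact (h'.p_eq h hσ hρ hDΩ hyD).trans (hp y hy)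
  rw [averVelocity, hzeta, hgrad, zero_smul, sub_zero]

theorem isPerfectShielding (h : IsSolution D Ω ζ₀ H P φ p)
    (hσ : IsSubharmonicDefiningFunction σ D) (hρ : IsSubharmonicDefiningFunction ρ Ω)
    (hDΩ : closure D ⊆ Ω) (hp : ∀ x ∈ frontier D, p x = 0) :
    IsPerfectShielding D Ω ζ₀ H P := by
  refine ⟨⟨φ, p, h⟩, fun φ' p' h' => setIntegral_eq_zero_of_forall_eq_zero fun x hx => ?_⟩
  have hxD : x ∈ Dᶜ := (hσ.isOpen.frontier_eq ▸ hx).2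
  rw [h'.p_eq h hσ hρ hDΩ hxD, hp x hx, neg_zero, zero_smul]

end IsSolution

/-! ### Solutions glued along the outer boundary -/

section Gluing

variable {X Y : Type*} [TopologicalSpace X] {D Ω : Set X} {p pi pe : X → Y} {x : X}

theorem continuousOn_compl_of_eqOn [TopologicalSpace Y] (hD : IsOpen D) (hΩ : IsOpen Ω)
    (hpi : ContinuousOn pi (closure Ω \ D)) (hpe : ContinuousOn pe Ωᶜ)
    (heqi : Set.EqOn p pi (closure Ω)) (heqe : Set.EqOn p pe Ωᶜ) : ContinuousOn p Dᶜ := by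
  have hunion := ((hpi.congr (heqi.mono Set.sdiff_subset)).union_of_isClosed (hpe.congr heqe)
    (isClosed_closure.sdiff hD) hΩ.isClosed_compl)
  refine hunion.mono fun x hx => ?_
  by_cases hxΩ : x ∈ Ω
  exacts [.inl ⟨subset_closure hxΩ, hx⟩, .inr hxΩ]

theorem eventuallyEq_of_eqOn_closure (hΩ : IsOpen Ω) (heqi : Set.EqOn p pi (closure Ω))
    (hx : x ∈ Ω) : p =ᶠ[𝓝 x] pi := by
  filter_upwards [hΩ.mem_nhds hx] with y hy using heqi (subset_closure hy)

theorem eventuallyEq_of_eqOn_compl (heqe : Set.EqOn p pe Ωᶜ) (hx : x ∉ closure Ω) :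
    p =ᶠ[𝓝 x] pe := by
  filter_upwards [isClosed_closure.isOpen_compl.mem_nhds hx] with y hy
    using heqe fun hyΩ => hy (subset_closure hyΩ)

end Gluing

theorem harmonicOnNhd_of_eqOn {E : Type*} [NormedAddCommGroup E] [InnerProductSpace ℝ E]
    [FiniteDimensional ℝ E] {D Ω : Set E} {p pi pe : E → ℝ} (hΩ : IsOpen Ω)
    (hpi : HarmonicOnNhd pi (closure Ω \ D)) (hpe : HarmonicOnNhd pe Ωᶜ)
    (heqi : Set.EqOn p pi (closure Ω)) (heqe : Set.EqOn p pe Ωᶜ) :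
    HarmonicOnNhd p ((closure D)ᶜ \ frontier Ω) := by
  rintro x ⟨hxD, hxΩ⟩
  by_cases hx : x ∈ Ω
  · exact (harmonicAt_congr_nhds (eventuallyEq_of_eqOn_closure hΩ heqi hx)).2
      (hpi x ⟨subset_closure hx, fun hmem => hxD (subset_closure hmem)⟩)
  · have hxc : x ∉ closure Ω := fun hmem => hxΩ (hΩ.frontier_eq ▸ ⟨hmem, hx⟩)
    exact (harmonicAt_congr_nhds (eventuallyEq_of_eqOn_compl heqe hxc)).2 (hpe x hx)

theorem isSolution_of_eqOn {D Ω : Set Plane} {ζ₀ : ℝ} {σ ρ H P φ p pi pe : Plane → ℝ}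
    (hσ : IsSubharmonicDefiningFunction σ D)
    (hρ : IsSubharmonicDefiningFunction ρ Ω) (hDΩ : closure D ⊆ Ω) (hbdd : Bornology.IsBounded Ω)
    (hφ : HarmonicOnNhd φ Dᶜ)
    (hφD : ∀ x ∈ frontier D, inner ℝ (∇ φ x) (outwardNormal D x) = 0)
    (hφH : (fun x => φ x - H x) =O[Bornology.cobounded Plane] fun x => ‖x‖⁻¹)
    (hpi : HarmonicOnNhd pi (closure Ω \ D)) (hpe : HarmonicOnNhd pe Ωᶜ)
    (heqi : Set.EqOn p pi (closure Ω)) (heqe : Set.EqOn p pe Ωᶜ)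
    (hpD : ∀ x ∈ frontier D, inner ℝ (∇ pi x) (outwardNormal D x) = 0)
    (hjump : ∀ x ∈ frontier Ω, inner ℝ (∇ pe x) (outwardNormal Ω x) -
      inner ℝ (∇ pi x) (outwardNormal Ω x) = 12 * ζ₀ * inner ℝ (∇ φ x) (outwardNormal Ω x))
    (hpP : (fun x => pe x - P x) =O[Bornology.cobounded Plane] fun x => ‖x‖⁻¹) :
    IsSolution D Ω ζ₀ H P φ p where
  phi_cont := hφ.continuousOn
  phi_harmonic := hφ.mono (Set.compl_subset_compl.2 subset_closure)
  phi_neumann x hx := hφD x hx ▸ .of_eventuallyEq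
    (hφ x (hσ.notMem_frontier_of_mem · hx)).1 (.of_forall fun _ => .rfl)
  phi_infty := hφH
  p_cont := continuousOn_compl_of_eqOn hσ.isOpen hρ.isOpen hpi.continuousOn hpe.continuousOn
    heqi heqe
  p_harmonic := harmonicOnNhd_of_eqOn hρ.isOpen hpi hpe heqi heqe
  p_neumann x hx := by
    have hxΩ : x ∈ Ω := hDΩ (frontier_subset_closure hx)
    exact hpD x hx ▸ .of_eventuallyEq
      (hpi x ⟨subset_closure hxΩ, (hσ.notMem_frontier_of_mem · hx)⟩).1
      (((tendsto_line_right x _).eventually (hρ.isOpen.mem_nhds hxΩ)).mono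
        fun _ => eventuallyEq_of_eqOn_closure hρ.isOpen heqi)
  p_jump x hx := by
    have hxD : x ∉ D := fun hmem =>
      notMem_closure_of_mem_frontier hρ.isOpen hDΩ hx (subset_closure hmem)
    exact ⟨_, _, .of_eventuallyEq (hpe x (hρ.notMem_frontier_of_mem · hx)).1
        ((hρ.eventually_add_outwardNormal_notMem_closure hx).mono
          fun _ => eventuallyEq_of_eqOn_compl heqe),
      .of_eventuallyEq (hpi x ⟨frontier_subset_closure hx, hxD⟩).1
        ((hρ.eventually_add_neg_outwardNormal_mem hx).mono
          fun _ => eventuallyEq_of_eqOn_closure hρ.isOpen heqi), hjump x hx⟩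
  p_infty := by
    refine hpP.congr' ?_ .rfl
    filter_upwards [Bornology.isBounded_def.1 hbdd] with x hx
    rw [heqe hx]

/-! ### Confocal ellipses -/

/-- The quadratic form minus one whose zero set is the ellipse with semi-axes `a` and `b`; it
defines the domains `ellipse l r` in the uniqueness argument. -/
noncomputable def ellipseForm (a b : ℝ) (x : Plane) : ℝ := (x 0 / a) ^ 2 + (x 1 / b) ^ 2 - 1

/-- The derivative of `ellipticPoint l ξ η` in `ξ`, an outward normal vector of the ellipses
`ξ = const`. -/
noncomputable def ellipticRadial (l ξ η : ℝ) : Plane :=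
  !₂[l * Real.sinh ξ * Real.cos η, l * Real.cosh ξ * Real.sin η]

theorem inner_plane (x y : Plane) : inner ℝ x y = x 0 * y 0 + x 1 * y 1 := by
  simp only [PiLp.inner_apply, Fin.sum_univ_two, RCLike.inner_apply', conj_trivial]

section EllipseForm

variable {a b : ℝ}

theorem contDiff_ellipseForm {k : WithTop ℕ∞} : ContDiff ℝ k (ellipseForm a b) := by
  unfold ellipseForm
  fun_prop

theorem ellipseForm_add_smul (x v : Plane) (t : ℝ) :
    ellipseForm a b (x + t • v) = ellipseForm a b x +
      t * inner ℝ !₂[2 * x 0 / a ^ 2, 2 * x 1 / b ^ 2] v +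
      t ^ 2 * ((v 0 / a) ^ 2 + (v 1 / b) ^ 2) := by
  simp only [ellipseForm, inner_plane, PiLp.add_apply, PiLp.smul_apply, smul_eq_mul,
    Matrix.cons_val_zero, Matrix.cons_val_one]
  ring

theorem hasDerivAt_quadratic (c₀ c₁ c₂ t : ℝ) :
    HasDerivAt (fun t : ℝ => c₀ + t * c₁ + t ^ 2 * c₂) (c₁ + t * (2 * c₂)) t := by
  refine ((((hasDerivAt_id t).mul_const c₁).const_add c₀).fun_add
    (((hasDerivAt_id t).fun_pow 2).mul_const c₂)).congr_deriv ?_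
  simp only [id, Nat.cast_ofNat, Nat.add_one_sub_one, pow_one]
  ring

theorem deriv_deriv_quadratic (c₀ c₁ c₂ t : ℝ) :
    deriv (deriv fun t : ℝ => c₀ + t * c₁ + t ^ 2 * c₂) t = 2 * c₂ := by
  rw [funext fun s => (hasDerivAt_quadratic c₀ c₁ c₂ s).deriv]
  exact (((hasDerivAt_id t).mul_const (2 * c₂)).const_add c₁).deriv.trans (one_mul _)

theorem gradient_ellipseForm (x : Plane) :
    ∇ (ellipseForm a b) x = !₂[2 * x 0 / a ^ 2, 2 * x 1 / b ^ 2] := by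
  refine ext_inner_right ℝ fun v => ?_
  have hline := hasDerivAt_comp_line_zero
    ((contDiff_ellipseForm (a := a) (b := b)).differentiable one_ne_zero x) v
  simp only [ellipseForm_add_smul] at hline
  simpa only [zero_mul, add_zero] using hline.unique (hasDerivAt_quadratic _ _ _ 0)

theorem inner_gradient_ellipseForm_self (x : Plane) :
    inner ℝ (∇ (ellipseForm a b) x) x = 2 * (ellipseForm a b x + 1) := by
  simp only [gradient_ellipseForm, inner_plane, ellipseForm, Matrix.cons_val_zero,
    Matrix.cons_val_one]
  ring

theorem laplacian_ellipseForm (x : Plane) :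
    Δ (ellipseForm a b) x = 2 * (a⁻¹ ^ 2 + b⁻¹ ^ 2) := by
  rw [laplacian_eq_iteratedFDeriv_orthonormalBasis _ (EuclideanSpace.basisFun (Fin 2) ℝ)]
  simp only [Fin.sum_univ_two, iteratedFDeriv_two_eq_deriv_deriv contDiff_ellipseForm.contDiffAt,
    ellipseForm_add_smul, deriv_deriv_quadratic]
  simp only [EuclideanSpace.basisFun_apply, PiLp.single_eq_same,
    PiLp.single_eq_of_ne _ zero_ne_one, PiLp.single_eq_of_ne _ one_ne_zero]
  ring

end EllipseForm

theorem hasDerivAt_ellipticPoint (l ξ η : ℝ) :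
    HasDerivAt (fun ξ => ellipticPoint l ξ η) (ellipticRadial l ξ η) ξ := by
  refine (PiLp.continuousLinearEquiv 2 ℝ fun _ : Fin 2 => ℝ).symm.hasFDerivAt.comp_hasDerivAt ξ
    (f := fun ξ => ![l * Real.cosh ξ * Real.cos η, l * Real.sinh ξ * Real.sin η])
    (f' := ![l * Real.sinh ξ * Real.cos η, l * Real.cosh ξ * Real.sin η])
    (hasDerivAt_pi.2 (Fin.forall_fin_two.2 ⟨?_, ?_⟩))
  · exact ((Real.hasDerivAt_cosh ξ).const_mul l).mul_const (Real.cos η)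
  · exact ((Real.hasDerivAt_sinh ξ).const_mul l).mul_const (Real.sin η)

theorem norm_ellipticPoint_le {l ξ : ℝ} (hl : 0 ≤ l) (hξ : 0 ≤ ξ) (η : ℝ) :
    ‖ellipticPoint l ξ η‖ ≤ l * Real.exp ξ := by
  have hsq : ‖ellipticPoint l ξ η‖ ^ 2 = (l * Real.cosh ξ) ^ 2 - (l * Real.sin η) ^ 2 := by
    simp only [← real_inner_self_eq_norm_sq, inner_plane, ellipticPoint,
      Matrix.cons_val_zero, Matrix.cons_val_one]
    linear_combination (l ^ 2 * Real.cosh ξ ^ 2) * Real.sin_sq_add_cos_sq η -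
      (l ^ 2 * Real.sin η ^ 2) * Real.cosh_sq ξ
  have hcosh : ‖ellipticPoint l ξ η‖ ≤ l * Real.cosh ξ :=
    le_of_sq_le_sq (by linarith [sq_nonneg (l * Real.sin η)])
      (mul_nonneg hl (Real.cosh_pos ξ).le)
  refine hcosh.trans (mul_le_mul_of_nonneg_left ?_ hl)
  linarith [Real.cosh_add_sinh ξ, Real.sinh_nonneg_iff.2 hξ]

section Ellipse

variable {l r s ξ : ℝ} {x : Plane}

theorem ellipseForm_ellipticPoint (hl : l ≠ 0) (hr : r ≠ 0) (ξ η : ℝ) :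
    ellipseForm (l * Real.cosh r) (l * Real.sinh r) (ellipticPoint l ξ η) =
      (Real.cosh ξ ^ 2 - Real.cosh r ^ 2) *
        ((Real.cos η / Real.cosh r) ^ 2 + (Real.sin η / Real.sinh r) ^ 2) := by
  have hcosh := (Real.cosh_pos r).ne'
  have hsinh := Real.sinh_ne_zero.2 hr
  simp only [ellipseForm, ellipticPoint, PiLp.toLp_apply, Matrix.cons_val_zero,
    Matrix.cons_val_one]
  field_simp
  rw [Real.cosh_sq ξ, Real.cosh_sq r, Real.cos_sq' η]
  ring

theorem cos_div_cosh_sq_add_sin_div_sinh_sq_pos (hr : r ≠ 0) (η : ℝ) :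
    0 < (Real.cos η / Real.cosh r) ^ 2 + (Real.sin η / Real.sinh r) ^ 2 := by
  rcases eq_or_ne (Real.cos η) 0 with hcos | hcos
  · have hsin : Real.sin η ≠ 0 := fun hsin => by
      simpa [hcos, hsin] using Real.sin_sq_add_cos_sq η
    positivity
  · positivity

theorem ellipseForm_ellipticPoint_neg_iff (hl : l ≠ 0) (hr : 0 < r) (hξ : 0 ≤ ξ) (η : ℝ) :
    ellipseForm (l * Real.cosh r) (l * Real.sinh r) (ellipticPoint l ξ η) < 0 ↔ ξ < r := by
  rw [ellipseForm_ellipticPoint hl hr.ne', mul_comm, ← smul_eq_mul,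
    smul_neg_iff_of_pos_left (cos_div_cosh_sq_add_sin_div_sinh_sq_pos hr.ne' η), sub_neg,
    sq_lt_sq₀ (Real.cosh_pos ξ).le (Real.cosh_pos r).le, Real.cosh_lt_cosh, abs_of_nonneg hξ,
    abs_of_pos hr]

theorem ellipseForm_ellipticPoint_eq_zero_iff (hl : l ≠ 0) (hr : 0 < r) (hξ : 0 ≤ ξ) (η : ℝ) :
    ellipseForm (l * Real.cosh r) (l * Real.sinh r) (ellipticPoint l ξ η) = 0 ↔ ξ = r := by
  rw [ellipseForm_ellipticPoint hl hr.ne',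
    mul_eq_zero_iff_right (cos_div_cosh_sq_add_sin_div_sinh_sq_pos hr.ne' η).ne', sub_eq_zero,
    sq_eq_sq₀ (Real.cosh_pos ξ).le (Real.cosh_pos r).le]
  exact Real.cosh_strictMonoOn.injOn.eq_iff hξ hr.le

theorem mem_ellipse_iff (hl : 0 < l) (hr : 0 < r) :
    x ∈ ellipse l r ↔ ellipseForm (l * Real.cosh r) (l * Real.sinh r) x < 0 := by
  constructor
  · rintro ⟨ξ, η, hξ, hξr, rfl⟩
    exact (ellipseForm_ellipticPoint_neg_iff hl.ne' hr hξ η).2 hξr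
  · obtain ⟨⟨ξ, η⟩, hξ, -, -, rfl⟩ := exists_ellipticCoords hl x
    exact fun h => ⟨ξ, η, hξ, (ellipseForm_ellipticPoint_neg_iff hl.ne' hr hξ η).1 h, rfl⟩

theorem gradient_ellipseForm_ellipticPoint (hl : l ≠ 0) (hr : r ≠ 0) (η : ℝ) :
    ∇ (ellipseForm (l * Real.cosh r) (l * Real.sinh r)) (ellipticPoint l r η) =
      (2 / (l ^ 2 * Real.sinh r * Real.cosh r)) • ellipticRadial l r η := by
  have hcosh := (Real.cosh_pos r).ne'
  have hsinh := Real.sinh_ne_zero.2 hr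
  rw [gradient_ellipseForm]
  ext i
  fin_cases i <;>
  · simp only [ellipticPoint, ellipticRadial, PiLp.smul_apply, smul_eq_mul, Fin.zero_eta,
      Fin.mk_one, Matrix.cons_val_zero, Matrix.cons_val_one]
    field_simp

theorem isSubharmonicDefiningFunction_ellipseForm (hl : 0 < l) (hr : 0 < r) :
    IsSubharmonicDefiningFunction (ellipseForm (l * Real.cosh r) (l * Real.sinh r))
      (ellipse l r) where
  contDiff := contDiff_ellipseForm
  laplacian_pos x := by
    rw [laplacian_ellipseForm]
    positivity
  gradient_ne_zero x hx hgrad := by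
    have hself := inner_gradient_ellipseForm_self (a := l * Real.cosh r) (b := l * Real.sinh r) x
    rw [hgrad, hx, inner_zero_left] at hself
    norm_num at hself
  mem_iff _ := mem_ellipse_iff hl hr

theorem exists_eq_ellipticPoint_of_mem_frontier (hl : 0 < l) (hr : 0 < r)
    (hx : x ∈ frontier (ellipse l r)) : ∃ η, x = ellipticPoint l r η := by
  obtain ⟨⟨ξ, η⟩, hξ, -, -, rfl⟩ := exists_ellipticCoords hl x
  rw [(isSubharmonicDefiningFunction_ellipseForm hl hr).mem_frontier_iff,
    ellipseForm_ellipticPoint_eq_zero_iff hl.ne' hr hξ] at hx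
  exact ⟨η, hx ▸ rfl⟩

theorem exists_eq_ellipticPoint_of_notMem (hl : 0 < l) (hx : x ∉ ellipse l r) :
    ∃ ξ η, r ≤ ξ ∧ x = ellipticPoint l ξ η := by
  obtain ⟨⟨ξ, η⟩, hξ, -, -, rfl⟩ := exists_ellipticCoords hl x
  exact ⟨ξ, η, le_of_not_gt fun hlt => hx ⟨ξ, η, hξ, hlt, rfl⟩, rfl⟩

theorem closure_ellipse_subset (hl : 0 < l) (hr : 0 < r) (hrs : r < s) :
    closure (ellipse l r) ⊆ ellipse l s := by
  rw [closure_eq_self_union_frontier, Set.union_subset_iff]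
  refine ⟨fun x ⟨ξ, η, hξ, hξr, hx⟩ => ⟨ξ, η, hξ, hξr.trans hrs, hx⟩, fun x hx => ?_⟩
  obtain ⟨η, rfl⟩ := exists_eq_ellipticPoint_of_mem_frontier hl hr hx
  exact ⟨r, η, hr.le, hrs, rfl⟩

theorem isBounded_ellipse (hl : 0 ≤ l) : Bornology.IsBounded (ellipse l r) := by
  refine isBounded_iff_forall_norm_le.2 ⟨l * Real.exp r, ?_⟩
  rintro _ ⟨ξ, η, hξ, hξr, rfl⟩
  exact (norm_ellipticPoint_le hl hξ η).trans
    (mul_le_mul_of_nonneg_left (Real.exp_le_exp.2 hξr.le) hl)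

theorem outwardNormal_ellipse (hl : 0 < l) (hr : 0 < r) (η : ℝ) :
    outwardNormal (ellipse l r) (ellipticPoint l r η) =
      ‖ellipticRadial l r η‖⁻¹ • ellipticRadial l r η := by
  have hρ := isSubharmonicDefiningFunction_ellipseForm hl hr
  have hmem : ellipticPoint l r η ∈ frontier (ellipse l r) :=
    hρ.mem_frontier_iff.2 ((ellipseForm_ellipticPoint_eq_zero_iff hl.ne' hr hr.le η).2 rfl)
  have hscale : 0 < 2 / (l ^ 2 * Real.sinh r * Real.cosh r) := by
    positivity
  rw [outwardNormal_eq (hρ.isOutwardUnitNormal hmem),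
    gradient_ellipseForm_ellipticPoint hl.ne' hr.ne', norm_smul, smul_smul,
    Real.norm_of_nonneg hscale.le, mul_inv, mul_right_comm, inv_mul_cancel₀ hscale.ne', one_mul]

theorem inner_gradient_outwardNormal_ellipse (hl : 0 < l) (hr : 0 < r) {f : Plane → ℝ} {η d : ℝ}
    (hf : DifferentiableAt ℝ f (ellipticPoint l r η))
    (hd : HasDerivAt (fun ξ => f (ellipticPoint l ξ η)) d r) :
    inner ℝ (∇ f (ellipticPoint l r η)) (outwardNormal (ellipse l r) (ellipticPoint l r η)) =
      ‖ellipticRadial l r η‖⁻¹ * d := by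
  rw [outwardNormal_ellipse hl hr, real_inner_smul_right, inner_gradient_left]
  exact congrArg _ ((hf.hasFDerivAt.comp_hasDerivAt r (hasDerivAt_ellipticPoint l r η)).unique hd)

end Ellipse

/-! ### Harmonic functions in conformal coordinates -/

section Isometry

variable {E F : Type*} [NormedAddCommGroup E] [InnerProductSpace ℝ E] [FiniteDimensional ℝ E]
  [NormedAddCommGroup F] [InnerProductSpace ℝ F] [FiniteDimensional ℝ F]

theorem laplacian_comp_linearIsometryEquiv {f : F → ℝ} (e : E ≃ₗᵢ[ℝ] F) {x : E}
    (hf : ContDiffAt ℝ 2 f (e x)) : Δ (f ∘ e) x = Δ f (e x) := by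
  have hline (v : E) (t : ℝ) : (f ∘ e) (x + t • v) = f (e x + t • e v) := by
    rw [Function.comp_apply, map_add, map_smul]
  have hfe : ContDiffAt ℝ 2 (f ∘ e) x := hf.comp x e.contDiff.contDiffAt
  rw [laplacian_eq_iteratedFDeriv_stdOrthonormalBasis,
    laplacian_eq_iteratedFDeriv_orthonormalBasis f ((stdOrthonormalBasis ℝ E).map e)]
  refine Finset.sum_congr rfl fun i _ => ?_
  simp only [iteratedFDeriv_two_eq_deriv_deriv hfe, iteratedFDeriv_two_eq_deriv_deriv hf, hline,
    OrthonormalBasis.map_apply]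

theorem harmonicAt_comp_linearIsometryEquiv {f : F → ℝ} (e : E ≃ₗᵢ[ℝ] F) {x : E}
    (hf : HarmonicAt f (e x)) : HarmonicAt (f ∘ e) x := by
  refine ⟨hf.1.comp x e.contDiff.contDiffAt, ?_⟩
  filter_upwards [e.continuous.continuousAt.eventually hf.eventually] with y hy
  rw [laplacian_comp_linearIsometryEquiv e hy.1, hy.2.self_of_nhds]
  rfl

end Isometry

/-- Since `c` has an analytic inverse near `w`, `g` is locally the real part of an analytic
function. -/
theorem harmonicAt_of_comp_eq_re {g : ℂ → ℝ} {c F : ℂ → ℂ} {w : ℂ} (hc : AnalyticAt ℂ c w)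
    (hc' : deriv c w ≠ 0) (hF : AnalyticAt ℂ F w) (hg : ∀ᶠ z in 𝓝 w, g (c z) = (F z).re) :
    HarmonicAt g (c w) := by
  set L := hc.hasStrictDerivAt.localInverse _ _ _ hc'
  have hL : AnalyticAt ℂ L (c w) := hc.analyticAt_localInverse hc'
  have hLw : L (c w) = w := HasStrictFDerivAt.localInverse_apply_image ..
  have hright : ∀ᶠ z in 𝓝 (c w), c (L z) = z := HasStrictDerivAt.eventually_right_inverse ..
  have hFL : AnalyticAt ℂ (F ∘ L) (c w) := AnalyticAt.comp (hLw.symm ▸ hF) hL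
  refine (harmonicAt_congr_nhds ?_).1 hFL.harmonicAt_re
  filter_upwards [hright, hL.continuousAt.eventually (hLw.symm ▸ hg)] with z hz hgz
  exact hgz.symm.trans (congrArg g hz)

/-- The isometry `x₁ + i x₂ ↦ (x₁, x₂)`, under which elliptic coordinates become the conformal map
`l cosh`. -/
noncomputable def toPlane : ℂ ≃ₗᵢ[ℝ] Plane := Complex.orthonormalBasisOneI.repr

/-- The elliptic harmonic `(A e^{nξ} + B e^{-nξ}) cos(nη - θ)`. -/
noncomputable def mode (l : ℝ) (n : ℕ) (θ A B : ℝ) (x : Plane) : ℝ :=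
  (A * Real.exp (n * (ellipticCoords l x).1) + B * Real.exp (-(n * (ellipticCoords l x).1))) *
    Real.cos (n * (ellipticCoords l x).2 - θ)

/-- The entire function of `ξ + iη` whose real part is `mode l n θ A B`. -/
noncomputable def analyticMode (n : ℕ) (θ A B : ℝ) (w : ℂ) : ℂ :=
  A * Complex.exp (n * w - θ * Complex.I) + B * Complex.exp (-(n * w - θ * Complex.I))

theorem toPlane_cosh (l ξ η : ℝ) :
    toPlane (l * Complex.cosh (ξ + η * Complex.I)) = ellipticPoint l ξ η := by
  have hcosh := cosh_nat_mul 1 ξ η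
  simp only [Nat.cast_one, one_mul] at hcosh
  rw [hcosh]
  ext i
  fin_cases i <;>
    simp [toPlane, Complex.orthonormalBasisOneI_repr_apply, ellipticPoint, mul_assoc]

theorem exp_eq_of_cosh_eq {w z : ℂ} (h : Complex.cosh w = Complex.cosh z) (hw : 0 < w.re)
    (hz : 0 ≤ z.re) : Complex.exp w = Complex.exp z := by
  have hprod : (Complex.exp w - Complex.exp z) * (Complex.exp w * Complex.exp z - 1) = 0 := by
    have hw0 := Complex.exp_ne_zero w
    have hz0 := Complex.exp_ne_zero z
    rw [Complex.cosh, Complex.cosh, Complex.exp_neg, Complex.exp_neg] at h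
    field_simp at h
    linear_combination h
  refine sub_eq_zero.1 ((mul_eq_zero.1 hprod).resolve_right fun hone => ?_)
  have hnorm := congrArg norm (sub_eq_zero.1 hone)
  rw [← Complex.exp_add, Complex.norm_exp, norm_one, Real.exp_eq_one_iff, Complex.add_re] at hnorm
  linarith

theorem sinh_ne_zero_of_re_pos {w : ℂ} (hw : 0 < w.re) : Complex.sinh w ≠ 0 := by
  intro h
  rw [Complex.sinh, div_eq_zero_iff, or_iff_left two_ne_zero, sub_eq_zero] at h
  have hnorm := congrArg norm h
  rw [Complex.norm_exp, Complex.norm_exp, Real.exp_eq_exp, Complex.neg_re] at hnorm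
  linarith

theorem analyticMode_re (n : ℕ) (θ A B ξ η : ℝ) :
    (analyticMode n θ A B (ξ + η * Complex.I)).re =
      (A * Real.exp (n * ξ) + B * Real.exp (-(n * ξ))) * Real.cos (n * η - θ) := by
  have harg : (n * (ξ + η * Complex.I) - θ * Complex.I : ℂ) = ⟨n * ξ, n * η - θ⟩ := by
    apply Complex.ext <;> simp
  simp only [analyticMode, harg, Complex.add_re, Complex.re_ofReal_mul, Complex.exp_re,
    Complex.neg_re, Complex.neg_im, Real.cos_neg]
  ring

theorem analyticMode_congr (n : ℕ) (θ A B : ℝ) {w z : ℂ} (h : Complex.exp w = Complex.exp z) :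
    analyticMode n θ A B w = analyticMode n θ A B z := by
  simp only [analyticMode, neg_sub, Complex.exp_sub, Complex.exp_nat_mul, h]

section Mode

variable {l r ξ : ℝ} {n : ℕ}

theorem mode_toPlane_cosh (hl : 0 < l) (n : ℕ) (θ A B : ℝ) {w : ℂ} (hw : 0 < w.re) :
    mode l n θ A B (toPlane (l * Complex.cosh w)) = (analyticMode n θ A B w).re := by
  obtain ⟨hξ, -, -, h⟩ := ellipticCoords_spec hl (toPlane (l * Complex.cosh w))
  rw [← toPlane_cosh] at h
  have hcosh := mul_left_cancel₀ (Complex.ofReal_ne_zero.2 hl.ne') (toPlane.injective h)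
  rw [mode, ← analyticMode_re,
    analyticMode_congr n θ A B (exp_eq_of_cosh_eq hcosh.symm hw (by simpa using hξ))]

theorem mode_ellipticPoint (hl : 0 < l) (n : ℕ) (θ A B : ℝ) (hξ : 0 < ξ) (η : ℝ) :
    mode l n θ A B (ellipticPoint l ξ η) =
      (A * Real.exp (n * ξ) + B * Real.exp (-(n * ξ))) * Real.cos (n * η - θ) := by
  rw [← toPlane_cosh, mode_toPlane_cosh hl n θ A B (by simpa using hξ), analyticMode_re]

theorem harmonicAt_mode (hl : 0 < l) (n : ℕ) (θ A B : ℝ) (hξ : 0 < ξ) (η : ℝ) :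
    HarmonicAt (mode l n θ A B) (ellipticPoint l ξ η) := by
  set w : ℂ := ξ + η * Complex.I with hw
  have hwre : 0 < w.re := by simpa [hw] using hξ
  have hderiv (z : ℂ) : HasDerivAt (fun z => l * Complex.cosh z) (l * Complex.sinh z) z :=
    (Complex.hasDerivAt_cosh z).const_mul _
  have hanalytic : Differentiable ℂ (analyticMode n θ A B) := by
    unfold analyticMode
    fun_prop
  have hℂ : HarmonicAt (mode l n θ A B ∘ toPlane) (l * Complex.cosh w) := by
    refine harmonicAt_of_comp_eq_re (c := fun z => l * Complex.cosh z)
      (Differentiable.analyticAt (fun z => (hderiv z).differentiableAt) w) ?_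
      (hanalytic.analyticAt w) ?_
    · rw [(hderiv w).deriv]
      exact mul_ne_zero (Complex.ofReal_ne_zero.2 hl.ne') (sinh_ne_zero_of_re_pos hwre)
    · filter_upwards [Complex.continuous_re.continuousAt.eventually (lt_mem_nhds hwre)] with z hz
        using mode_toPlane_cosh hl n θ A B hz
  rw [← toPlane_cosh]
  have h := harmonicAt_comp_linearIsometryEquiv toPlane.symm
    (x := toPlane (l * Complex.cosh w)) (by rwa [toPlane.symm_apply_apply])
  rwa [Function.comp_assoc, LinearIsometryEquiv.self_comp_symm, Function.comp_id] at h

theorem harmonicOnNhd_mode (hl : 0 < l) (hr : 0 < r) (n : ℕ) (θ A B : ℝ) :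
    HarmonicOnNhd (mode l n θ A B) (ellipse l r)ᶜ := by
  intro x hx
  obtain ⟨ξ, η, hξ, rfl⟩ := exists_eq_ellipticPoint_of_notMem hl hx
  exact harmonicAt_mode hl n θ A B (hr.trans_le hξ) η

theorem inner_gradient_mode (hl : 0 < l) (hr : 0 < r) (n : ℕ) (θ A B η : ℝ) :
    inner ℝ (∇ (mode l n θ A B) (ellipticPoint l r η))
        (outwardNormal (ellipse l r) (ellipticPoint l r η)) =
      ‖ellipticRadial l r η‖⁻¹ *
        (n * (A * Real.exp (n * r) - B * Real.exp (-(n * r))) * Real.cos (n * η - θ)) := by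
  refine inner_gradient_outwardNormal_ellipse hl hr
    ((harmonicAt_mode hl n θ A B hr η).1.differentiableAt two_ne_zero) ?_
  have hmul : HasDerivAt (fun ξ : ℝ => n * ξ) (n : ℝ) r := hasDerivAt_const_mul _
  refine HasDerivAt.congr_of_eventuallyEq (((hmul.exp.const_mul A).fun_add
    (hmul.fun_neg.exp.const_mul B)).mul_const (Real.cos (n * η - θ)) |>.congr_deriv (by ring)) ?_
  filter_upwards [lt_mem_nhds hr] with ξ hξ using mode_ellipticPoint hl n θ A B hξ η

theorem mode_sub (l : ℝ) (n : ℕ) (θ A B A' B' : ℝ) (x : Plane) :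
    mode l n θ A B x - mode l n θ A' B' x = mode l n θ (A - A') (B - B') x := by
  simp only [mode]
  ring

theorem mul_mode (l : ℝ) (n : ℕ) (θ A B c : ℝ) (x : Plane) :
    c * mode l n θ A B x = mode l n θ (c * A) (c * B) x := by
  simp only [mode]
  ring

theorem abs_mode_zero_left_le (hn : 1 ≤ n) {x : Plane} (hξ : 0 ≤ (ellipticCoords l x).1)
    (θ B : ℝ) : |mode l n θ 0 B x| ≤ |B| * Real.exp (-(ellipticCoords l x).1) := by
  have hmono : (ellipticCoords l x).1 ≤ n * (ellipticCoords l x).1 :=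
    le_mul_of_one_le_left hξ (Nat.one_le_cast.2 hn)
  rw [mode, zero_mul, zero_add, abs_mul, abs_mul, Real.abs_exp]
  refine (mul_le_of_le_one_right (by positivity) (Real.abs_cos_le_one _)).trans ?_
  gcongr

theorem mode_zero_left_isBigO (hl : 0 < l) (hn : 1 ≤ n) (θ B : ℝ) :
    mode l n θ 0 B =O[Bornology.cobounded Plane] fun x => ‖x‖⁻¹ := by
  refine IsBigO.of_bound (|B| * l) ?_
  filter_upwards [tendsto_norm_cobounded_atTop.eventually_gt_atTop 0] with x hx
  obtain ⟨hξ, -, -, hcoords⟩ := ellipticCoords_spec hl x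
  have hnorm := norm_ellipticPoint_le hl.le hξ (ellipticCoords l x).2
  rw [hcoords] at hnorm
  have hdecay : Real.exp (-(ellipticCoords l x).1) ≤ l * ‖x‖⁻¹ := by
    rwa [Real.exp_neg, ← div_eq_mul_inv, inv_le_comm₀ (Real.exp_pos _) (by positivity), inv_div,
      div_le_iff₀' hl]
  rw [norm_inv, norm_norm, Real.norm_eq_abs, mul_assoc]
  exact (abs_mode_zero_left_le hn hξ θ B).trans (mul_le_mul_of_nonneg_left hdecay (abs_nonneg B))

theorem fieldCos_eq_mode (l : ℝ) (n : ℕ) : fieldCos l n = mode l n 0 (1 / 2) (1 / 2) := by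
  funext x
  rw [fieldCos, mode, Real.cosh_eq, sub_zero]
  ring

theorem fieldSin_eq_mode (l : ℝ) (n : ℕ) :
    fieldSin l n = mode l n (Real.pi / 2) (1 / 2) (-(1 / 2)) := by
  funext x
  rw [fieldSin, mode, Real.sinh_eq, Real.cos_sub_pi_div_two]
  ring

end Mode

/-! ### Modal solutions -/

/-- The elliptic harmonic `C cosh(n(ξ - r)) cos(nη - θ)`, whose normal derivative vanishes on the
boundary of `ellipse l r`. -/
noncomputable def neumannMode (l : ℝ) (n : ℕ) (θ r C : ℝ) : Plane → ℝ :=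
  mode l n θ (C / 2 * Real.exp (-(n * r))) (C / 2 * Real.exp (n * r))

section NeumannMode

variable {l r s ξi ξe θ ζ₀ A B A' B' C b : ℝ} {n : ℕ}

theorem neumannMode_ellipticPoint (hl : 0 < l) (n : ℕ) (θ r C : ℝ) (hs : 0 < s) (η : ℝ) :
    neumannMode l n θ r C (ellipticPoint l s η) =
      C * Real.cosh (n * (s - r)) * Real.cos (n * η - θ) := by
  rw [neumannMode, mode_ellipticPoint hl n θ _ _ hs, mul_assoc (C / 2), mul_assoc (C / 2),
    ← Real.exp_add, ← Real.exp_add, Real.cosh_eq]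
  ring_nf

theorem inner_gradient_neumannMode (hl : 0 < l) (hs : 0 < s) (n : ℕ) (θ r C η : ℝ) :
    inner ℝ (∇ (neumannMode l n θ r C) (ellipticPoint l s η))
        (outwardNormal (ellipse l s) (ellipticPoint l s η)) =
      ‖ellipticRadial l s η‖⁻¹ * (n * (C * Real.sinh (n * (s - r))) * Real.cos (n * η - θ)) := by
  rw [neumannMode, inner_gradient_mode hl hs, mul_assoc (C / 2), mul_assoc (C / 2),
    ← Real.exp_add, ← Real.exp_add, Real.sinh_eq]
  ring_nf

theorem inner_gradient_neumannMode_self (hl : 0 < l) (hr : 0 < r) (n : ℕ) (θ C : ℝ) {x : Plane}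
    (hx : x ∈ frontier (ellipse l r)) :
    inner ℝ (∇ (neumannMode l n θ r C) x) (outwardNormal (ellipse l r) x) = 0 := by
  obtain ⟨η, rfl⟩ := exists_eq_ellipticPoint_of_mem_frontier hl hr hx
  rw [inner_gradient_neumannMode hl hr, sub_self, mul_zero, Real.sinh_zero, mul_zero, mul_zero,
    zero_mul, mul_zero]

theorem mode_sub_mode_isBigO (hl : 0 < l) (hn : 1 ≤ n) (θ A B B' : ℝ) :
    (fun x => mode l n θ A B x - mode l n θ A B' x) =O[Bornology.cobounded Plane]
      fun x => ‖x‖⁻¹ := by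
  simpa only [mode_sub, sub_self] using mode_zero_left_isBigO hl hn θ (B - B')

theorem neumannMode_sub_mode_isBigO (hl : 0 < l) (hn : 1 ≤ n) (θ r A B : ℝ) :
    (fun x => neumannMode l n θ r (2 * A * Real.exp (n * r)) x - mode l n θ A B x)
      =O[Bornology.cobounded Plane] fun x => ‖x‖⁻¹ := by
  have hA : 2 * A * Real.exp (n * r) / 2 * Real.exp (-(n * r)) = A := by
    rw [div_mul_eq_mul_div, mul_assoc, ← Real.exp_add, add_neg_cancel, Real.exp_zero, mul_one,
      mul_div_cancel_left₀ _ two_ne_zero]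
  simpa only [neumannMode, hA] using mode_sub_mode_isBigO hl hn θ A _ B

/-- `hcont` and `hjump` are the transmission conditions on the outer ellipse, for the field
`neumannMode l n θ ξi C` inside and `mode l n θ A' b` outside. -/
theorem exists_isSolution_mode (hl : 0 < l) (hi : 0 < ξi) (hie : ξi < ξe) (hn : 1 ≤ n)
    (hcont : C * Real.cosh (n * (ξe - ξi)) =
      A' * Real.exp (n * ξe) + b * Real.exp (-(n * ξe)))
    (hjump : A' * Real.exp (n * ξe) - b * Real.exp (-(n * ξe)) - C * Real.sinh (n * (ξe - ξi)) =
      12 * ζ₀ * (2 * A * Real.exp (n * ξi) * Real.sinh (n * (ξe - ξi)))) :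
    ∃ φ p, IsSolution (ellipse l ξi) (ellipse l ξe) ζ₀ (mode l n θ A B) (mode l n θ A' B') φ p ∧
      Set.EqOn p (neumannMode l n θ ξi C) (closure (ellipse l ξe)) ∧
      Set.EqOn p (mode l n θ A' b) (ellipse l ξe)ᶜ := by
  classical
  have he := hi.trans hie
  have hρ := isSubharmonicDefiningFunction_ellipseForm hl he
  set p := (ellipse l ξe).piecewise (neumannMode l n θ ξi C) (mode l n θ A' b)
  have heqe : Set.EqOn p (mode l n θ A' b) (ellipse l ξe)ᶜ := Set.piecewise_eqOn_compl ..
  have heqi : Set.EqOn p (neumannMode l n θ ξi C) (closure (ellipse l ξe)) := by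
    intro x hx
    by_cases hmem : x ∈ ellipse l ξe
    · exact Set.piecewise_eq_of_mem _ _ _ hmem
    have hfront : x ∈ frontier (ellipse l ξe) := hρ.isOpen.frontier_eq ▸ ⟨hx, hmem⟩
    obtain ⟨η, rfl⟩ := exists_eq_ellipticPoint_of_mem_frontier hl he hfront
    rw [heqe hmem, neumannMode_ellipticPoint hl n θ ξi C he, mode_ellipticPoint hl n θ _ _ he,
      hcont]
  refine ⟨neumannMode l n θ ξi (2 * A * Real.exp (n * ξi)), p, ?_, heqi, heqe⟩
  refine isSolution_of_eqOn (pi := neumannMode l n θ ξi C)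
    (isSubharmonicDefiningFunction_ellipseForm hl hi) hρ
    (closure_ellipse_subset hl hi hie) (isBounded_ellipse hl.le) (harmonicOnNhd_mode hl hi n θ _ _)
    (fun _ => inner_gradient_neumannMode_self hl hi n θ _)
    (neumannMode_sub_mode_isBigO hl hn ..)
    ((harmonicOnNhd_mode hl hi n θ _ _).mono fun _ => And.right) (harmonicOnNhd_mode hl he n θ _ _)
    heqi heqe (fun _ => inner_gradient_neumannMode_self hl hi n θ _) (fun x hx => ?_)
    (mode_sub_mode_isBigO hl hn ..)
  obtain ⟨η, rfl⟩ := exists_eq_ellipticPoint_of_mem_frontier hl he hx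
  rw [inner_gradient_mode hl he, inner_gradient_neumannMode hl he, inner_gradient_neumannMode hl he]
  linear_combination
    ‖ellipticRadial l ξe η‖⁻¹ * n * Real.cos (n * η - θ) * hjump

theorem isPerfectCloaking_mode (hl : 0 < l) (hi : 0 < ξi) (hie : ξi < ξe) (hn : 1 ≤ n)
    (hζ : ζ₀ * (24 * A * Real.exp (n * ξi) * Real.sinh (n * (ξe - ξi)) *
        Real.cosh (n * (ξe - ξi))) =
      A' * Real.exp (n * ξi) - B' * Real.exp (-(n * ξi))) :
    IsPerfectCloaking (ellipse l ξi) (ellipse l ξe) ζ₀ (mode l n θ A B) (mode l n θ A' B') := by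
  have hcosh := (Real.cosh_pos (n * (ξe - ξi))).ne'
  have hexp : Real.exp (n * ξe) *
      (Real.cosh (n * (ξe - ξi)) - Real.sinh (n * (ξe - ξi))) = Real.exp (n * ξi) := by
    rw [Real.cosh_sub_sinh, ← Real.exp_add]
    ring_nf
  have hexp_neg : Real.exp (-(n * ξe)) *
      (Real.cosh (n * (ξe - ξi)) + Real.sinh (n * (ξe - ξi))) = Real.exp (-(n * ξi)) := by
    rw [Real.cosh_add_sinh, ← Real.exp_add]
    ring_nf
  set C := (A' * Real.exp (n * ξe) + B' * Real.exp (-(n * ξe))) / Real.cosh (n * (ξe - ξi))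
  have hcont : C * Real.cosh (n * (ξe - ξi)) =
      A' * Real.exp (n * ξe) + B' * Real.exp (-(n * ξe)) := div_mul_cancel₀ _ hcosh
  obtain ⟨φ, p, h, -, hp⟩ := exists_isSolution_mode (A := A) (ζ₀ := ζ₀) (B := B) (B' := B')
    (θ := θ) hl hi hie hn hcont <| mul_left_cancel₀ hcosh <| by
      linear_combination A' * hexp - B' * hexp_neg - hζ - Real.sinh (n * (ξe - ξi)) * hcont
  exact h.isPerfectCloaking (isSubharmonicDefiningFunction_ellipseForm hl hi)
    (isSubharmonicDefiningFunction_ellipseForm hl (hi.trans hie))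
    (closure_ellipse_subset hl hi hie) fun x hx => hp fun hmem => hx (subset_closure hmem)

theorem isPerfectShielding_mode (hl : 0 < l) (hi : 0 < ξi) (hie : ξi < ξe) (hn : 1 ≤ n)
    (hζ : ζ₀ * (12 * A * Real.exp (n * ξi) * Real.sinh (n * (ξe - ξi))) =
      A' * Real.exp (n * ξe)) :
    IsPerfectShielding (ellipse l ξi) (ellipse l ξe) ζ₀ (mode l n θ A B) (mode l n θ A' B') := by
  have hexp : Real.exp (n * ξe) * Real.exp (-(n * ξe)) = 1 := by
    rw [← Real.exp_add, add_neg_cancel, Real.exp_zero]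
  obtain ⟨φ, p, h, hp, -⟩ := exists_isSolution_mode (A := A) (A' := A') (ζ₀ := ζ₀) (B := B)
    (B' := B') (θ := θ) (C := 0) (b := -(A' * Real.exp (n * ξe) ^ 2)) hl hi hie hn
    (by linear_combination A' * Real.exp (n * ξe) * hexp)
    (by linear_combination A' * Real.exp (n * ξe) * hexp - 2 * hζ)
  have hDΩ := closure_ellipse_subset hl hi hie
  refine h.isPerfectShielding (isSubharmonicDefiningFunction_ellipseForm hl hi)
    (isSubharmonicDefiningFunction_ellipseForm hl (hi.trans hie)) hDΩ fun x hx => ?_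
  rw [hp (subset_closure (hDΩ (frontier_subset_closure hx)))]
  simp only [neumannMode, mode, zero_div, zero_mul, add_zero]

end NeumannMode

theorem sinh_sub_exp_mul_sinh (a b : ℝ) :
    Real.sinh b - Real.exp (a - b) * Real.sinh a = Real.exp a * Real.sinh (b - a) := by
  simp only [Real.sinh_eq, Real.exp_sub, Real.exp_neg]
  field_simp
  ring

theorem cosh_sub_exp_mul_cosh (a b : ℝ) :
    Real.cosh b - Real.exp (a - b) * Real.cosh a = Real.exp a * Real.sinh (b - a) := by
  simp only [Real.sinh_eq, Real.cosh_eq, Real.exp_sub, Real.exp_neg]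
  field_simp
  ring

end ElectroOsmosis

theorem mainTheorem2 (l ξi ξe : ℝ) (hl : 0 < l) (hi : 0 < ξi) (hie : ξi < ξe)
    (n : ℕ) (hn : 1 ≤ n) :
    (IsPerfectCloaking (ellipse l ξi) (ellipse l ξe)
        (Real.sinh (n * ξi) /
          ((Real.sinh (n * ξe) - Real.exp (n * (ξi - ξe)) * Real.sinh (n * ξi)) *
            Real.cosh (n * (ξe - ξi))))
        (fieldCos l n) (fun x => 12 * fieldCos l n x) ∧
      IsPerfectShielding (ellipse l ξi) (ellipse l ξe)
        (Real.exp (n * ξe) /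
          (Real.sinh (n * ξe) - Real.exp (n * (ξi - ξe)) * Real.sinh (n * ξi)))
        (fieldCos l n) (fun x => 12 * fieldCos l n x)) ∧
    (IsPerfectCloaking (ellipse l ξi) (ellipse l ξe)
        (Real.cosh (n * ξi) /
          ((Real.cosh (n * ξe) - Real.exp (n * (ξi - ξe)) * Real.cosh (n * ξi)) *
            Real.cosh (n * (ξe - ξi))))
        (fieldSin l n) (fun x => 12 * fieldSin l n x) ∧
      IsPerfectShielding (ellipse l ξi) (ellipse l ξe)
        (Real.exp (n * ξe) /
          (Real.cosh (n * ξe) - Real.exp (n * (ξi - ξe)) * Real.cosh (n * ξi)))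
        (fieldSin l n) (fun x => 12 * fieldSin l n x)) ∧
    Real.exp (n * ξe) /
        (Real.sinh (n * ξe) - Real.exp (n * (ξi - ξe)) * Real.sinh (n * ξi)) =
      Real.exp (n * ξe) /
        (Real.cosh (n * ξe) - Real.exp (n * (ξi - ξe)) * Real.cosh (n * ξi)) := by
  have hd : 0 < n * (ξe - ξi) := mul_pos (by exact_mod_cast hn) (sub_pos.2 hie)
  have hsinh := (Real.sinh_pos_iff.2 hd).ne'
  have hcosh := (Real.cosh_pos (n * (ξe - ξi))).ne'
  have hS := sinh_sub_exp_mul_sinh (n * ξi) (n * ξe)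
  have hC := cosh_sub_exp_mul_cosh (n * ξi) (n * ξe)
  simp only [← mul_sub] at hS hC
  simp only [fieldCos_eq_mode, fieldSin_eq_mode, mul_mode, hS, hC, and_true]
  refine ⟨⟨?_, ?_⟩, ?_, ?_⟩
  · refine isPerfectCloaking_mode hl hi hie hn ?_
    rw [Real.sinh_eq (n * ξi)]
    field_simp
    ring
  · refine isPerfectShielding_mode hl hi hie hn ?_
    field_simp
  · refine isPerfectCloaking_mode hl hi hie hn ?_
    rw [Real.cosh_eq (n * ξi)]
    field_simp
    ring
  · refine isPerfectShielding_mode hl hi hie hn ?_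
    field_simp
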